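/- **Lemma 4.2.** Let $m\ge 1$ and let $B,A_{-1},A_0,A_1$ be nonnegative $m\times m$ matrices with $(B+A_1)\mathbf 1=\mathbf 1$ and $(A_{-1}+A_0+A_1)\mathbf 1=\mathbf 1$. Consider the quasi-birth-and-death (QBD) process on $\mathbb N\times\{1,\dots,m\}$ with the block tridiagonal transition matrix $$P=\begin{bmatrix}B&A_1\\A_{-1}&A_0&A_1\\&A_{-1}&A_0&\ddots\\&&\ddots&\ddots\end{bmatrix}.$$ Assume that $P$ and $A_{-1}+A_0+A_1$ are irreducible; that the doubly infinite QBD on $\mathbb Z\times\{1,\dots,m\}$ with blocks $A_{-1},A_0,A_1$ has exactly one final class, of the form $\mathbb Z\times\mathcal E_*$ with $\emptyset\neq\mathcal E_*\subseteq\{1,\dots,m\}$, every other state being on a path to it; and that the QBD is not null recurrent, i.e. it is positive recurrent or transient. Let $G$, $\widehat G$ and $R$ be the minimal nonnegative solutions of, respectively, $$A_{-1}+(A_0-I)X+A_1X^2=0,\qquad A_1+(A_0-I)X+A_{-1}X^2=0,\qquad A_1+X(A_0-I)+X^2A_{-1}=0 .$$ Let $U=A_0+RA_{-1}$. Then $U-I$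 is nonsingular and the series $$W=\sum_{j=0}^{\infty}G^j(U-I)^{-1}R^j$$ converges. Let $M=[\,L\mid K\,]$ be a nonsingular complex matrix, with $L$ of size $m\times p$ and $K$ of size $m\times(m-p)$, where $0\le p\le m$, such that $$\widehat G M=M\begin{bmatrix}V_1&0\\0&V_0\end{bmatrix},$$ where $V_1$ is $p\times p$ and nonsingular and $V_0$ is $(m-p)\times(m-p)$ with spectral radius $\rho(V_0)=0$. Partition $M^{-1}=\begin{bmatrix}E\\F\end{bmatrix}$ with $E$ of size $p\times m$ and $F$ of size $(m-p)\times m$. Let $\nu$ be the smallest nonnegative integer with $V_0^{\nu}=0$, and let $(g_r)_{r\ge0}$ be any sequence of vectors in $\mathbb C^m$. Then $$\sigma_r=-\sum_{k=1}^{r}\bigl(G^{r-k}-LV_1^{k-r}E\bigr)Wg_k-\sum_{j=1}^{\nu-1}KV_0^{j}FWg_{j+r},\qquad r\ge0,$$ is a particular solution of the difference equation $$A_{-1}u_r+(A_0-I)u_{r+1}+A_1u_{r+2}=-g_{r+1},\qquad r\ge0. \tag{1}$$ The general solution of (1) is $$u_r=G^rx+LV_1^{-r}y+\sigma_r,\qquad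 r\ge0,$$ with $x\in\mathbb C^m$ and $y\in\mathbb C^p$ arbitrary: a sequence $(u_r)_{r\ge0}$ in $\mathbb C^m$ satisfies (1) if and only if it has this form for some $x$ and $y$. -/

import Mathlib

open scoped ENNReal

namespace QBD

noncomputable section

/-! ### Countable Markov chains: first passage, transience, positive recurrence -/

/-- `firstPassage P t n s` is the probability that a Markov chain with transition matrix `P`,
started in `s`, is in `t` at time `n + 1` and not in `t` at any of the times `1, …, n`. -/
def firstPassage {S : Type*} [DecidableEq S] (P : Matrix S S ℝ) (t : S) : ℕ → S → ℝ≥0∞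
  | 0, s => ENNReal.ofReal (P s t)
  | n + 1, s => ∑' u, if u = t then 0 else ENNReal.ofReal (P s u) * firstPassage P t n u

/-- The probability of ever returning to `s` when starting in `s`. -/
def returnProb {S : Type*} [DecidableEq S] (P : Matrix S S ℝ) (s : S) : ℝ≥0∞ :=
  ∑' n : ℕ, firstPassage P s n s

/-- The sum `∑ₙ n · ℙ(the first return to s occurs at time n)`. It is the expected return time
to `s` when the return is almost sure. -/
def meanReturnTime {S : Type*} [DecidableEq S] (P : Matrix S S ℝ) (s : S) : ℝ≥0∞ :=
  ∑' n : ℕ, ((n : ℝ≥0∞) + 1) * firstPassage P s n s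

/-- Every state is transient: return has probability less than one. -/
def IsTransient {S : Type*} [DecidableEq S] (P : Matrix S S ℝ) : Prop :=
  ∀ s, returnProb P s < 1

/-- Every state is positive recurrent: return is almost sure, in finite expected time. -/
def IsPositiveRecurrent {S : Type*} [DecidableEq S] (P : Matrix S S ℝ) : Prop :=
  ∀ s, returnProb P s = 1 ∧ meanReturnTime P s < ⊤

/-- `t` can be reached from `s` by transitions of positive probability. -/
def Reaches {S : Type*} (P : Matrix S S ℝ) (s t : S) : Prop :=
  Relation.ReflTransGen (fun a b => 0 < P a b) s t

/-! ### Quasi-birth-and-death processes -/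

/-- The transition matrix of the QBD on `ℕ × {1, …, m}` (level, phase): the block tridiagonal
matrix with `B` in the corner, `A0` on the rest of the diagonal, `A1` above the diagonal and
`Am` (standing for `A₋₁`) below it. -/
def transitionMatrix {m : ℕ} (B Am A0 A1 : Matrix (Fin m) (Fin m) ℝ) :
    Matrix (ℕ × Fin m) (ℕ × Fin m) ℝ := fun s t =>
  if t.1 = s.1 + 1 then A1 s.2 t.2
  else if t.1 = s.1 then (if s.1 = 0 then B s.2 t.2 else A0 s.2 t.2)
  else if s.1 = t.1 + 1 then Am s.2 t.2
  else 0

/-- The transition matrix of the doubly infinite QBD on `ℤ × {1, …, m}`. -/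
def doublyInfiniteMatrix {m : ℕ} (Am A0 A1 : Matrix (Fin m) (Fin m) ℝ) :
    Matrix (ℤ × Fin m) (ℤ × Fin m) ℝ := fun s t =>
  if t.1 = s.1 + 1 then A1 s.2 t.2
  else if t.1 = s.1 then A0 s.2 t.2
  else if s.1 = t.1 + 1 then Am s.2 t.2
  else 0

/-- The doubly infinite QBD has exactly one final (that is, closed communicating) class, this
class has the form `ℤ × Es` with `Es` nonempty, and every other state is on a path to it. -/
def HasOneFinalClass {m : ℕ} (Am A0 A1 : Matrix (Fin m) (Fin m) ℝ) : Prop :=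
  ∃ Es : Set (Fin m), Es.Nonempty ∧
    (∀ s t : ℤ × Fin m, s.2 ∈ Es →
      (Reaches (doublyInfiniteMatrix Am A0 A1) s t ↔ t.2 ∈ Es)) ∧
    (∀ s : ℤ × Fin m, s.2 ∉ Es →
      ∃ t : ℤ × Fin m, t.2 ∈ Es ∧ Reaches (doublyInfiniteMatrix Am A0 A1) s t)

/-- The blocks `B, A₋₁, A₀, A₁` define a QBD process (the transition matrix is stochastic) which
satisfies the standing irreducibility assumptions. -/
structure IsQBD {m : ℕ} (B Am A0 A1 : Matrix (Fin m) (Fin m) ℝ) : Prop where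
  B_nonneg : ∀ i j, 0 ≤ B i j
  Am_nonneg : ∀ i j, 0 ≤ Am i j
  A0_nonneg : ∀ i j, 0 ≤ A0 i j
  A1_nonneg : ∀ i j, 0 ≤ A1 i j
  row_sum_zero : ∀ i, ∑ j, (B + A1) i j = 1
  row_sum_succ : ∀ i, ∑ j, (Am + A0 + A1) i j = 1
  irreducible : (transitionMatrix B Am A0 A1).IsIrreducible
  phase_irreducible : (Am + A0 + A1).IsIrreducible
  one_final_class : HasOneFinalClass Am A0 A1

/-- `X` is the minimal (entrywise) among the entrywise nonnegative solutions of `Φ X = 0`. -/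
def IsMinNonnegSol {m : ℕ} (Φ : Matrix (Fin m) (Fin m) ℝ → Matrix (Fin m) (Fin m) ℝ)
    (X : Matrix (Fin m) (Fin m) ℝ) : Prop :=
  (∀ i j, 0 ≤ X i j) ∧ Φ X = 0 ∧
    ∀ Y : Matrix (Fin m) (Fin m) ℝ, (∀ i j, 0 ≤ Y i j) → Φ Y = 0 → ∀ i j, X i j ≤ Y i j

/-- The terms `Gʲ (U - I)⁻¹ Rʲ` of the series `W`, where `U = A₀ + R A₋₁`. -/
def Wterm {m : ℕ} (Am A0 G R : Matrix (Fin m) (Fin m) ℝ) (j : ℕ) : Matrix (Fin m) (Fin m) ℝ :=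
  G ^ j * (A0 + R * Am - 1)⁻¹ * R ^ j

/-- `W = ∑ⱼ Gʲ (U - I)⁻¹ Rʲ`. -/
def W {m : ℕ} (Am A0 G R : Matrix (Fin m) (Fin m) ℝ) : Matrix (Fin m) (Fin m) ℝ :=
  ∑' j : ℕ, Wterm Am A0 G R j

/-- A real matrix regarded as a complex one. -/
def toC {m : ℕ} (X : Matrix (Fin m) (Fin m) ℝ) : Matrix (Fin m) (Fin m) ℂ :=
  X.map Complex.ofReal

/-- The particular solution
`σᵣ = -∑_{k=1}^{r} (G^{r-k} - L V₁^{k-r} E) W gₖ - ∑_{j=1}^{ν-1} K V₀ʲ F W g_{j+r}`,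
with `ν` the smallest natural number such that `V₀^ν = 0`. -/
def sigma {m p q : ℕ} (G W : Matrix (Fin m) (Fin m) ℂ)
    (L : Matrix (Fin m) (Fin p) ℂ) (K : Matrix (Fin m) (Fin q) ℂ)
    (V1 : Matrix (Fin p) (Fin p) ℂ) (V0 : Matrix (Fin q) (Fin q) ℂ)
    (E : Matrix (Fin p) (Fin m) ℂ) (F : Matrix (Fin q) (Fin m) ℂ)
    (g : ℕ → Fin m → ℂ) (r : ℕ) : Fin m → ℂ :=
  -(∑ k ∈ Finset.Icc 1 r, ((G ^ (r - k) - L * V1⁻¹ ^ (r - k) * E) * W).mulVec (g k))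
    - ∑ j ∈ Finset.Ico 1 (nilpotencyClass V0), (K * V0 ^ j * F * W).mulVec (g (j + r))

/-- `u` solves `A₋₁ uᵣ + (A₀ - I) uᵣ₊₁ + A₁ uᵣ₊₂ = -gᵣ₊₁` for all `r ≥ 0`. -/
def SolvesDiffEq {m : ℕ} (Am A0 A1 : Matrix (Fin m) (Fin m) ℂ) (g u : ℕ → Fin m → ℂ) : Prop :=
  ∀ r : ℕ, Am.mulVec (u r) + (A0 - 1).mulVec (u (r + 1)) + A1.mulVec (u (r + 2)) = -g (r + 1)

end

end QBD

/-! Everything rests on inverting H = A₋₁Ĝ + (A₀ - I) + A₁G, and W turns out to be H⁻¹. Put V = I -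
U with U = A₀ + A₁G, and N = I - GĜ. The equations for G and Ĝ give A₋₁ = VG, H = -VN and A₁N = VNĜ.
A comparison of minimal solutions gives RA₋₁ = A₁G and R = A₁V⁻¹ (`Blocks.R_mul`), so R =
(VN)Ĝ(VN)⁻¹ is similar to Ĝ. Then D = -N⁻¹V⁻¹ satisfies D = (U - I)⁻¹ + GDR, and iterating this
identity shows that the series W converges to D (`Blocks.W_spec`).

Invertibility of V and N comes from a maximum principle on ℤ × phases: a subharmonic function that
attains its maximum attains it on every level at one fixed phase, because the maximum spreads along
paths into the final class. A vector fixed by U or by GĜ extends to such a function by powers of G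
upwards and by zero or powers of Ĝ downwards (`Blocks.isUnit_one_sub_U`,
`Blocks.isUnit_one_sub_mul`). For N this needs Gⁿ → 0 or Ĝⁿ → 0.

That decay is where recurrence enters. A minimal solution is stochastic or has powers tending to
zero (`Blocks.stochastic_or_tendsto_zero`). Transience excludes a stochastic G, since otherwise the
visit probability of a state of level 0 would have a minimum. Positive recurrence excludes that G
and Ĝ are both stochastic: finite mean descent times force a negative drift, whereas a stochastic Ĝ
forces a nonnegative one.

The rest is algebra. The coefficients of σ form a Green function, built from Gᵈ and LV₁⁻ᵈE on one
side and KV₀ᵈF on the other, with jump HW = I (`sigmaCoeff_equation`). Conversely, for a homogeneous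
solution the defect vᵣ₊₁ - Gvᵣ, multiplied by N⁻¹, satisfies zᵣ = Ĝzᵣ₊₁. Running this forever kills
the nilpotent part and leaves multiples of LV₁⁻ʳ (`exists_of_homogeneous`). -/

open Matrix Filter Topology

namespace QBD

variable {m : ℕ}

/-! ### Entrywise nonnegative matrices -/

/-- Entrywise nonnegativity. -/
def EntryNonneg (X : Matrix (Fin m) (Fin m) ℝ) : Prop := ∀ i j, 0 ≤ X i j

theorem EntryNonneg.add {X Y : Matrix (Fin m) (Fin m) ℝ} (hX : EntryNonneg X)
    (hY : EntryNonneg Y) : EntryNonneg (X + Y) := fun i j => add_nonneg (hX i j) (hY i j)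

theorem EntryNonneg.mul {X Y : Matrix (Fin m) (Fin m) ℝ} (hX : EntryNonneg X)
    (hY : EntryNonneg Y) : EntryNonneg (X * Y) := fun i j => by
  rw [Matrix.mul_apply]
  exact Finset.sum_nonneg fun k _ => mul_nonneg (hX i k) (hY k j)

theorem EntryNonneg.zero : EntryNonneg (0 : Matrix (Fin m) (Fin m) ℝ) := fun _ _ => le_rfl

theorem EntryNonneg.one : EntryNonneg (1 : Matrix (Fin m) (Fin m) ℝ) := fun i j => by
  rw [Matrix.one_apply]; split_ifs <;> simp

theorem EntryNonneg.pow {X : Matrix (Fin m) (Fin m) ℝ} (hX : EntryNonneg X) (n : ℕ) :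
    EntryNonneg (X ^ n) := by
  induction n with
  | zero => simpa using EntryNonneg.one
  | succ n ih => rw [pow_succ]; exact ih.mul hX

theorem mulVec_apply {n n' : ℕ} {α : Type*} [NonUnitalNonAssocSemiring α]
    (X : Matrix (Fin n) (Fin n') α) (u : Fin n' → α)
    (i : Fin n) : (X *ᵥ u) i = ∑ k, X i k * u k := rfl

theorem EntryNonneg.mulVec_mono {X : Matrix (Fin m) (Fin m) ℝ} (hX : EntryNonneg X)
    {u v : Fin m → ℝ} (h : u ≤ v) : X *ᵥ u ≤ X *ᵥ v := fun i => by
  rw [mulVec_apply, mulVec_apply]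
  exact Finset.sum_le_sum fun k _ => mul_le_mul_of_nonneg_left (h k) (hX i k)

theorem EntryNonneg.mulVec_nonneg {X : Matrix (Fin m) (Fin m) ℝ} (hX : EntryNonneg X)
    {u : Fin m → ℝ} (h : 0 ≤ u) : 0 ≤ X *ᵥ u := by
  simpa using hX.mulVec_mono h

theorem EntryNonneg.abs_mulVec_le {X : Matrix (Fin m) (Fin m) ℝ} (hX : EntryNonneg X)
    (v : Fin m → ℝ) (i : Fin m) : |(X *ᵥ v) i| ≤ (X *ᵥ fun k => |v k|) i := by
  rw [mulVec_apply, mulVec_apply]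
  refine (Finset.abs_sum_le_sum_abs _ _).trans (le_of_eq ?_)
  refine Finset.sum_congr rfl fun k _ => ?_
  rw [abs_mul, abs_of_nonneg (hX i k)]

theorem mul_entry_mono {X X' Y Y' : Matrix (Fin m) (Fin m) ℝ} (hX : EntryNonneg X)
    (hY : EntryNonneg Y) (h : ∀ i j, X i j ≤ X' i j) (h' : ∀ i j, Y i j ≤ Y' i j) (i j : Fin m) :
    (X * Y) i j ≤ (X' * Y') i j := by
  simp only [Matrix.mul_apply]
  exact Finset.sum_le_sum fun k _ =>
    mul_le_mul (h i k) (h' k j) (hY k j) ((hX i k).trans (h i k))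

/-- A sub-stochastic matrix does not increase the bound of a vector. -/
theorem EntryNonneg.mulVec_le_const {X : Matrix (Fin m) (Fin m) ℝ} (hX : EntryNonneg X)
    (h1 : X *ᵥ 1 ≤ 1) {v : Fin m → ℝ} {c : ℝ} (hc : 0 ≤ c) (hv : ∀ i, v i ≤ c) (i : Fin m) :
    (X *ᵥ v) i ≤ c := by
  have h := hX.mulVec_mono (u := v) (v := c • 1) (fun i => by simpa using hv i) i
  rw [Matrix.mulVec_smul] at h
  have h2 := h1 i
  simp only [Pi.smul_apply, smul_eq_mul, Pi.one_apply] at h h2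
  nlinarith

theorem EntryNonneg.pow_mulVec_one_le {X : Matrix (Fin m) (Fin m) ℝ} (hX : EntryNonneg X)
    (h1 : X *ᵥ 1 ≤ 1) (n : ℕ) : X ^ n *ᵥ 1 ≤ 1 := by
  induction n with
  | zero => simp
  | succ n ih =>
    rw [pow_succ, ← Matrix.mulVec_mulVec]
    exact ((hX.pow n).mulVec_mono h1).trans ih

theorem EntryNonneg.entry_le_mulVec_one {X : Matrix (Fin m) (Fin m) ℝ} (hX : EntryNonneg X)
    (i j : Fin m) : X i j ≤ (X *ᵥ 1) i := by
  simp only [Matrix.mulVec, dotProduct, Pi.one_apply, mul_one]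
  exact Finset.single_le_sum (fun k _ => hX i k) (Finset.mem_univ j)

/-- If `1 - X` is invertible and the powers of the nonnegative matrix `X` are bounded, then the
Neumann series of `X` converges. -/
theorem EntryNonneg.summable_pow {X : Matrix (Fin m) (Fin m) ℝ} (hX : EntryNonneg X) {b : ℝ}
    (hb : ∀ n i j, (X ^ n) i j ≤ b) (hu : IsUnit (1 - X)) (i j : Fin m) :
    Summable fun n => (X ^ n) i j := by
  obtain ⟨Z, hZ⟩ := hu.exists_left_inv
  have key : ∀ n, ∑ k ∈ Finset.range n, X ^ k = Z * (1 - X ^ n) := fun n => by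
    rw [← mul_neg_geom_sum, ← mul_assoc, hZ, one_mul]
  refine summable_of_sum_range_le (c := ∑ k, |Z i k| * (1 + b)) (fun n => hX.pow n i j) fun n => ?_
  have h1 : ∑ k ∈ Finset.range n, (X ^ k) i j = (Z * (1 - X ^ n)) i j := by
    rw [← key, Matrix.sum_apply]
  rw [h1, Matrix.mul_apply]
  refine Finset.sum_le_sum fun k _ => ?_
  refine (le_abs_self _).trans ?_
  rw [abs_mul]
  refine mul_le_mul_of_nonneg_left ?_ (abs_nonneg _)
  have h2 := hX.pow n k j
  have h3 := hb n k j
  have h4 : (0:ℝ) ≤ (1 : Matrix (Fin m) (Fin m) ℝ) k j := EntryNonneg.one k j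
  have h5 : (1 : Matrix (Fin m) (Fin m) ℝ) k j ≤ 1 := by
    rw [Matrix.one_apply]; split_ifs <;> simp
  rw [Matrix.sub_apply, abs_le]
  constructor <;> linarith

theorem isUnit_one_sub_of_forall_mulVec {X : Matrix (Fin m) (Fin m) ℝ}
    (h : ∀ v, X *ᵥ v = v → v = 0) : IsUnit (1 - X) := by
  rw [← Matrix.mulVec_injective_iff_isUnit]
  intro u v huv
  have : X *ᵥ (u - v) = u - v := by
    have h2 : (1 - X) *ᵥ (u - v) = 0 := by
      rw [Matrix.mulVec_sub]; simpa [sub_eq_zero] using huv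
    rw [Matrix.sub_mulVec, Matrix.one_mulVec, sub_eq_zero] at h2
    exact h2.symm
  exact sub_eq_zero.mp (h _ this)

theorem tendsto_mulVec {ι : Type*} {l : Filter ι} {X : ι → Matrix (Fin m) (Fin m) ℝ}
    {u : ι → Fin m → ℝ} {Y : Matrix (Fin m) (Fin m) ℝ} {v : Fin m → ℝ}
    (hX : Tendsto X l (𝓝 Y)) (hu : Tendsto u l (𝓝 v)) :
    Tendsto (fun n => X n *ᵥ u n) l (𝓝 (Y *ᵥ v)) := by
  have : Continuous fun p : Matrix (Fin m) (Fin m) ℝ × (Fin m → ℝ) => p.1 *ᵥ p.2 :=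
    continuous_fst.matrix_mulVec continuous_snd
  exact (this.tendsto (Y, v)).comp (hX.prodMk_nhds hu)

/-- If the powers of the nonnegative matrix `X` are bounded, the inverse of `1 - X` (if it exists)
is nonnegative. -/
theorem EntryNonneg.inv_one_sub_nonneg {X Z : Matrix (Fin m) (Fin m) ℝ} (hX : EntryNonneg X)
    {b : ℝ} (hb : ∀ n i j, (X ^ n) i j ≤ b) (hZ : Z * (1 - X) = 1) : EntryNonneg Z := by
  have hu : IsUnit (1 - X) := IsUnit.of_mul_eq_one_right Z hZ
  have hs := hX.summable_pow hb hu
  have h0 : Tendsto (fun n => X ^ n) atTop (𝓝 0) :=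
    tendsto_pi_nhds.2 fun i => tendsto_pi_nhds.2 fun j => (hs i j).tendsto_atTop_zero
  have h1 : Tendsto (fun n => Z * (1 - X ^ n)) atTop (𝓝 Z) := by
    have := (tendsto_const_nhds (x := Z)).mul ((tendsto_const_nhds (x := (1 : Matrix (Fin m) (Fin m) ℝ))).sub h0)
    simpa using this
  intro i j
  have h2 : Tendsto (fun n => (Z * (1 - X ^ n) : Matrix (Fin m) (Fin m) ℝ) i j) atTop (𝓝 (Z i j)) :=
    tendsto_pi_nhds.1 (tendsto_pi_nhds.1 h1 i) j
  refine ge_of_tendsto' h2 fun n => ?_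
  rw [← mul_neg_geom_sum, ← mul_assoc, hZ, one_mul, Matrix.sum_apply]
  exact Finset.sum_nonneg fun k _ => hX.pow k i j

end QBD

namespace QBD

variable {m : ℕ}

/-! ### Doubly infinite processes: the maximum principle -/

/-- Blocks of a doubly infinite QBD for which bounded subharmonic functions obey a maximum
principle: if the maximum is attained on level `0`, it is attained on all levels in some fixed
phase. -/
structure Blocks (Am A0 A1 : Matrix (Fin m) (Fin m) ℝ) : Prop where
  Am_nonneg : EntryNonneg Am
  A0_nonneg : EntryNonneg A0
  A1_nonneg : EntryNonneg A1
  row_sum : Am *ᵥ 1 + A0 *ᵥ 1 + A1 *ᵥ 1 = 1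
  max_principle : ∃ j, ∀ (y : ℤ → Fin m → ℝ) (i : Fin m), (∀ n k, y n k ≤ y 0 i) →
    (∀ n, y n ≤ Am *ᵥ y (n - 1) + A0 *ᵥ y n + A1 *ᵥ y (n + 1)) → ∀ n, y n j = y 0 i

/-- Reflecting the levels n ↦ -n exchanges the roles of G and Ĝ, so each result about G also yields
one about Ĝ. -/
theorem Blocks.swap {Am A0 A1 : Matrix (Fin m) (Fin m) ℝ} (h : Blocks Am A0 A1) :
    Blocks A1 A0 Am where
  Am_nonneg := h.A1_nonneg
  A0_nonneg := h.A0_nonneg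
  A1_nonneg := h.Am_nonneg
  row_sum := Eq.trans (by abel) h.row_sum
  max_principle := by
    obtain ⟨j, hj⟩ := h.max_principle
    refine ⟨j, fun y i hmax hsub n => ?_⟩
    have := hj (fun n => y (-n)) i (fun n k => by simpa using hmax (-n) k) (fun n => ?_) (-n)
    · simpa using this
    · have h1 := hsub (-n)
      have e1 : -(n - 1) = -n + 1 := by ring
      have e2 : -(n + 1) = -n - 1 := by ring
      rw [e1, e2]
      refine h1.trans (le_of_eq ?_)
      abel

/-- One step of the maximum principle. -/
theorem eq_of_sum_mul_ge {ι : Type*} (s : Finset ι) {a y : ι → ℝ} {M : ℝ} (ha : ∀ k ∈ s, 0 ≤ a k)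
    (hsum : ∑ k ∈ s, a k = 1) (hy : ∀ k ∈ s, y k ≤ M) (h : M ≤ ∑ k ∈ s, a k * y k) {k : ι}
    (hk : k ∈ s) (hpos : 0 < a k) : y k = M := by
  have h1 : ∑ k ∈ s, a k * (M - y k) = M - ∑ k ∈ s, a k * y k := by
    simp only [mul_sub, Finset.sum_sub_distrib, ← Finset.sum_mul, hsum, one_mul]
  have h2 : ∀ k ∈ s, 0 ≤ a k * (M - y k) := fun k hk =>
    mul_nonneg (ha k hk) (sub_nonneg.2 (hy k hk))
  have h3 := Finset.single_le_sum h2 hk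
  have h4 : a k * (M - y k) ≤ 0 := by linarith
  have h5 : M - y k ≤ 0 := by
    by_contra hc
    exact absurd h4 (not_le.2 (mul_pos hpos (not_le.1 hc)))
  exact le_antisymm (hy k hk) (by linarith)

theorem IsQBD.row_sum {B Am A0 A1 : Matrix (Fin m) (Fin m) ℝ} (h : IsQBD B Am A0 A1) :
    Am *ᵥ 1 + A0 *ᵥ 1 + A1 *ᵥ 1 = 1 := by
  ext i
  have := h.row_sum_succ i
  simp only [Matrix.add_apply] at this
  simpa [mulVec_apply, Finset.sum_add_distrib] using this

theorem three_blocks_max_step {a b c u v w : Fin m → ℝ} {M : ℝ}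
    (ha : ∀ k, 0 ≤ a k) (hb : ∀ k, 0 ≤ b k) (hc : ∀ k, 0 ≤ c k)
    (hsum : ∑ k, a k + ∑ k, b k + ∑ k, c k = 1)
    (hu : ∀ k, u k ≤ M) (hv : ∀ k, v k ≤ M) (hw : ∀ k, w k ≤ M)
    (h : M ≤ ∑ k, a k * u k + ∑ k, b k * v k + ∑ k, c k * w k) (l : Fin m) :
    (0 < a l → u l = M) ∧ (0 < b l → v l = M) ∧ (0 < c l → w l = M) := by
  have key := fun k hk => eq_of_sum_mul_ge (Finset.univ : Finset (Fin m ⊕ Fin m ⊕ Fin m))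
    (a := Sum.elim a (Sum.elim b c)) (y := Sum.elim u (Sum.elim v w)) (M := M)
    (by rintro (k | k | k) _ <;> simp [ha, hb, hc])
    (by simpa [Fintype.sum_sum_type, add_assoc] using hsum)
    (by rintro (k | k | k) _ <;> simp [hu, hv, hw])
    (by simpa [Fintype.sum_sum_type, add_assoc] using h) (k := k) hk
  exact ⟨fun h => by simpa using key (Sum.inl l) (Finset.mem_univ _) (by simpa using h),
    fun h => by simpa using key (Sum.inr (Sum.inl l)) (Finset.mem_univ _) (by simpa using h),
    fun h => by simpa using key (Sum.inr (Sum.inr l)) (Finset.mem_univ _) (by simpa using h)⟩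

/-- The states where the maximum is attained are closed under transitions. Paths lead from any of
them into the final class, and from there to every level in the phase `j`. -/
theorem IsQBD.blocks {B Am A0 A1 : Matrix (Fin m) (Fin m) ℝ} (h : IsQBD B Am A0 A1) :
    Blocks Am A0 A1 where
  Am_nonneg := h.Am_nonneg
  A0_nonneg := h.A0_nonneg
  A1_nonneg := h.A1_nonneg
  row_sum := h.row_sum
  max_principle := by
    obtain ⟨Es, ⟨j, hj⟩, hEs, hout⟩ := h.one_final_class
    refine ⟨j, fun y i hmax hsub n => ?_⟩
    have step : ∀ s t : ℤ × Fin m, 0 < doublyInfiniteMatrix Am A0 A1 s t →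
        y s.1 s.2 = y 0 i → y t.1 t.2 = y 0 i := by
      rintro ⟨a, k⟩ ⟨b, l⟩ hpos hs
      simp only at hs ⊢
      have hsum := congrFun h.row_sum k
      simp only [Pi.add_apply, mulVec_apply, Pi.one_apply, mul_one] at hsum
      have hk := hsub a k
      rw [hs] at hk
      obtain ⟨h1, h2, h3⟩ := three_blocks_max_step (h.Am_nonneg k) (h.A0_nonneg k)
        (h.A1_nonneg k) hsum (hmax (a - 1)) (hmax a) (hmax (a + 1)) hk l
      simp only [doublyInfiniteMatrix] at hpos
      split_ifs at hpos with c1 c2 c3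
      · rw [c1]; exact h3 hpos
      · rw [c2]; exact h2 hpos
      · have : b = a - 1 := by omega
        rw [this]; exact h1 hpos
      · exact absurd hpos (lt_irrefl _)
    have reach : ∀ s t : ℤ × Fin m, Reaches (doublyInfiniteMatrix Am A0 A1) s t →
        y s.1 s.2 = y 0 i → y t.1 t.2 = y 0 i := by
      intro s t hst hs
      induction hst with
      | refl => exact hs
      | tail _ hbc ih => exact step _ _ hbc ih
    by_cases hi : i ∈ Es
    · exact reach (0, i) (n, j) ((hEs (0, i) (n, j) hi).2 hj) rfl
    · obtain ⟨t, ht, hr⟩ := hout (0, i) hi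
      exact reach t (n, j) ((hEs t (n, j) ht).2 hj) (reach (0, i) t hr rfl)

/-- A vector that is harmonic for the phase process is constant. -/
theorem Blocks.const_of_harmonic {Am A0 A1 : Matrix (Fin m) (Fin m) ℝ} (h : Blocks Am A0 A1)
    {v : Fin m → ℝ} (hv : Am *ᵥ v + A0 *ᵥ v + A1 *ᵥ v = v) : ∃ c, ∀ i, v i = c := by
  obtain ⟨j, hj⟩ := h.max_principle
  have : Nonempty (Fin m) := ⟨j⟩
  obtain ⟨i, hi⟩ := Finite.exists_max v
  obtain ⟨i', hi'⟩ := Finite.exists_min v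
  -- Extended independently of the level, both `v` and `-v` attain their maximum at the same phase
  -- `j`, so max and min of `v` agree.
  have h1 := hj (fun _ => v) i (fun _ k => hi k) (fun _ => hv.ge) 0
  have h2 := hj (fun _ => -v) i' (fun _ k => by simpa using hi' k)
    (fun _ => by simp only [Matrix.mulVec_neg]; rw [← neg_add, ← neg_add, hv]) 0
  simp only [Pi.neg_apply, neg_inj] at h1 h2
  exact ⟨v j, fun k => le_antisymm (by rw [h1]; exact hi k) (by rw [h2]; exact hi' k)⟩

/-! ### The minimal solution of the quadratic equation as a limit -/

/-- Natural iteration for the equation `X = A₋₁ + A₀ X + A₁ X²`, started at zero. -/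
noncomputable def solIter (Am A0 A1 : Matrix (Fin m) (Fin m) ℝ) : ℕ → Matrix (Fin m) (Fin m) ℝ
  | 0 => 0
  | k + 1 => Am + A0 * solIter Am A0 A1 k + A1 * solIter Am A0 A1 k ^ 2

section Iter

variable {Am A0 A1 G : Matrix (Fin m) (Fin m) ℝ} (h : Blocks Am A0 A1)
include h

theorem Blocks.solIter_nonneg (k : ℕ) : EntryNonneg (solIter Am A0 A1 k) := by
  induction k with
  | zero => exact EntryNonneg.zero
  | succ k ih =>
    exact (h.Am_nonneg.add (h.A0_nonneg.mul ih)).add (h.A1_nonneg.mul (ih.pow 2))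

theorem Blocks.quadratic_mono {X Y : Matrix (Fin m) (Fin m) ℝ} (hX : EntryNonneg X)
    (hXY : ∀ i j, X i j ≤ Y i j) (i j : Fin m) :
    (Am + A0 * X + A1 * X ^ 2) i j ≤ (Am + A0 * Y + A1 * Y ^ 2) i j := by
  simp only [Matrix.add_apply, pow_two]
  have h1 := mul_entry_mono h.A0_nonneg hX (fun _ _ => le_rfl) hXY i j
  have h2 := mul_entry_mono h.A1_nonneg (hX.mul hX) (fun _ _ => le_rfl)
    (mul_entry_mono hX hX hXY hXY) i j
  linarith

theorem Blocks.solIter_mono (k : ℕ) (i j : Fin m) :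
    solIter Am A0 A1 k i j ≤ solIter Am A0 A1 (k + 1) i j := by
  induction k generalizing i j with
  | zero => exact h.solIter_nonneg 1 i j
  | succ k ih => exact h.quadratic_mono (h.solIter_nonneg k) ih i j

theorem Blocks.solIter_mulVec_one_le (k : ℕ) : solIter Am A0 A1 k *ᵥ 1 ≤ 1 := by
  induction k with
  | zero => simp [solIter]
  | succ k ih =>
    have h1 := h.A0_nonneg.mulVec_mono ih
    have h2 := h.A1_nonneg.mulVec_mono ((h.solIter_nonneg k).pow_mulVec_one_le ih 2)
    simp only [solIter, Matrix.add_mulVec, ← Matrix.mulVec_mulVec]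
    calc _ ≤ Am *ᵥ 1 + A0 *ᵥ 1 + A1 *ᵥ 1 := by gcongr
      _ = 1 := h.row_sum

omit h in
theorem quadratic_eq_iff {X : Matrix (Fin m) (Fin m) ℝ} :
    Am + (A0 - 1) * X + A1 * X ^ 2 = 0 ↔ Am + A0 * X + A1 * X ^ 2 = X := by
  rw [sub_mul, one_mul, ← sub_eq_zero (a := Am + A0 * X + A1 * X ^ 2)]
  constructor <;> intro h <;> rw [← h] <;> abel

variable (hG : IsMinNonnegSol (fun X => Am + (A0 - 1) * X + A1 * X ^ 2) G)
include hG

omit h in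
theorem IsMinNonnegSol.quadratic_eq : Am + A0 * G + A1 * G ^ 2 = G := quadratic_eq_iff.1 hG.2.1

theorem Blocks.solIter_le (k : ℕ) (i j : Fin m) : solIter Am A0 A1 k i j ≤ G i j := by
  induction k generalizing i j with
  | zero => exact hG.1 i j
  | succ k ih =>
    rw [← hG.quadratic_eq]
    exact h.quadratic_mono (h.solIter_nonneg k) ih i j

/-- The iterates increase and stay below `G`; their limit is a nonnegative solution, hence equals
`G` by minimality. Inequalities for `G` can thus be proved by induction along the iteration. -/
theorem Blocks.tendsto_solIter : Tendsto (solIter Am A0 A1) atTop (𝓝 G) := by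
  have hex : ∀ i j, ∃ l, Tendsto (fun k => solIter Am A0 A1 k i j) atTop (𝓝 l) := fun i j =>
    ⟨_, tendsto_atTop_ciSup (monotone_nat_of_le_succ fun k => h.solIter_mono k i j)
      ⟨G i j, by rintro _ ⟨k, rfl⟩; exact h.solIter_le hG k i j⟩⟩
  choose Y hY using hex
  have hY' : Tendsto (solIter Am A0 A1) atTop (𝓝 (Matrix.of Y)) :=
    tendsto_pi_nhds.2 fun i => tendsto_pi_nhds.2 fun j => hY i j
  have hnn : EntryNonneg (Matrix.of Y) := fun i j =>
    ge_of_tendsto' (hY i j) fun k => h.solIter_nonneg k i j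
  have hle : ∀ i j, Matrix.of Y i j ≤ G i j := fun i j =>
    le_of_tendsto' (hY i j) fun k => h.solIter_le hG k i j
  have hsol : Am + A0 * Matrix.of Y + A1 * Matrix.of Y ^ 2 = Matrix.of Y := by
    refine tendsto_nhds_unique ?_ (hY'.comp (tendsto_add_atTop_nat 1))
    exact (tendsto_const_nhds.add (tendsto_const_nhds.mul hY')).add
      (tendsto_const_nhds.mul (hY'.pow 2))
  have : G = Matrix.of Y := by
    ext i j
    exact le_antisymm (hG.2.2 _ hnn (quadratic_eq_iff.2 hsol) i j) (hle i j)
  rwa [this]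

theorem Blocks.sol_mulVec_one_le : G *ᵥ 1 ≤ 1 :=
  le_of_tendsto' (tendsto_mulVec (h.tendsto_solIter hG) tendsto_const_nhds)
    fun k => h.solIter_mulVec_one_le k

theorem Blocks.pow_sol_le_one (n : ℕ) (i j : Fin m) : (G ^ n) i j ≤ 1 := by
  have hnn : EntryNonneg G := hG.1
  exact ((hnn.pow n).entry_le_mulVec_one i j).trans
    (hnn.pow_mulVec_one_le (h.sol_mulVec_one_le hG) n i)

/-- The minimal solution is stochastic, or its powers tend to zero. -/
theorem Blocks.stochastic_or_tendsto_zero :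
    G *ᵥ 1 = 1 ∨ Tendsto (fun n => G ^ n) atTop (𝓝 0) := by
  have hnn : EntryNonneg G := hG.1
  have h1 := h.sol_mulVec_one_le hG
  have hex : ∀ i, ∃ l, Tendsto (fun n => (G ^ n *ᵥ (1 : Fin m → ℝ)) i) atTop (𝓝 l) := fun i =>
    ⟨_, tendsto_atTop_ciInf (antitone_nat_of_succ_le fun n => by
        rw [pow_succ, ← Matrix.mulVec_mulVec]
        exact (hnn.pow n).mulVec_mono h1 i)
      ⟨0, by rintro _ ⟨n, rfl⟩; exact (hnn.pow n).mulVec_nonneg zero_le_one i⟩⟩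
  choose v hv using hex
  have hv' : Tendsto (fun n => G ^ n *ᵥ (1 : Fin m → ℝ)) atTop (𝓝 v) := tendsto_pi_nhds.2 hv
  have hGv : G *ᵥ v = v := by
    refine tendsto_nhds_unique (tendsto_mulVec tendsto_const_nhds hv') ?_
    have := hv'.comp (tendsto_add_atTop_nat 1)
    refine this.congr fun n => ?_
    simp only [Function.comp, pow_succ', Matrix.mulVec_mulVec]
  -- Since `G` fixes the limit `v` of Gⁿ1, the quadratic equation applied to `v` says that `v` is
  -- harmonic for the phase process, hence constant.
  have hAv : Am *ᵥ v + A0 *ᵥ v + A1 *ᵥ v = v := by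
    have := congrArg (fun X => X *ᵥ v) hG.quadratic_eq
    simp only [Matrix.add_mulVec, ← Matrix.mulVec_mulVec, pow_two, hGv] at this
    exact this
  obtain ⟨c, hc⟩ := h.const_of_harmonic hAv
  have hvc : v = c • (1 : Fin m → ℝ) := by ext i; simp [hc]
  by_cases hc0 : c = 0
  · right
    refine tendsto_pi_nhds.2 fun i => tendsto_pi_nhds.2 fun j => ?_
    have h0 := hv i
    rw [hc, hc0] at h0
    exact squeeze_zero (fun n => hnn.pow n i j) (fun n => (hnn.pow n).entry_le_mulVec_one i j) h0
  · left
    rw [hvc, Matrix.mulVec_smul] at hGv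
    exact smul_right_injective _ hc0 hGv

end Iter

end QBD

namespace QBD

variable {m : ℕ}

/-! ### The matrix `U = A₀ + A₁ G` and the factorization -/

theorem tendsto_pow_mulVec_eq_zero {X : Matrix (Fin m) (Fin m) ℝ} {v : Fin m → ℝ}
    (hX : Tendsto (fun n => X ^ n) atTop (𝓝 0)) (hv : X *ᵥ v = v) : v = 0 := by
  have h1 : ∀ n : ℕ, X ^ n *ᵥ v = v := fun n => by
    induction n with
    | zero => simp
    | succ n ih => rw [pow_succ, ← Matrix.mulVec_mulVec, hv, ih]
  have h2 := tendsto_mulVec hX (tendsto_const_nhds (x := v))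
  simp only [h1, Matrix.zero_mulVec] at h2
  exact tendsto_nhds_unique tendsto_const_nhds h2

theorem isUnit_one_sub_of_tendsto {X : Matrix (Fin m) (Fin m) ℝ}
    (hX : Tendsto (fun n => X ^ n) atTop (𝓝 0)) : IsUnit (1 - X) :=
  isUnit_one_sub_of_forall_mulVec fun _ hv => tendsto_pow_mulVec_eq_zero hX hv

/-- The two-sided sequence with `a 0, a 1, …` on the levels `0, 1, …` and `b 0, b 1, …` on the
levels `-1, -2, …`. -/
def glue (a b : ℕ → Fin m → ℝ) : ℤ → Fin m → ℝ
  | Int.ofNat k => a k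
  | Int.negSucc k => b k

theorem Blocks.glue_max_principle {Am A0 A1 : Matrix (Fin m) (Fin m) ℝ} (h : Blocks Am A0 A1) :
    ∃ j, ∀ (a b : ℕ → Fin m → ℝ) (i : Fin m),
      (∀ n k, a n k ≤ a 0 i) → (∀ n k, b n k ≤ a 0 i) →
      (∀ n, a (n + 1) ≤ Am *ᵥ a n + A0 *ᵥ a (n + 1) + A1 *ᵥ a (n + 2)) →
      (a 0 ≤ Am *ᵥ b 0 + A0 *ᵥ a 0 + A1 *ᵥ a 1) →
      (b 0 ≤ Am *ᵥ b 1 + A0 *ᵥ b 0 + A1 *ᵥ a 0) →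
      (∀ n, b (n + 1) ≤ Am *ᵥ b (n + 2) + A0 *ᵥ b (n + 1) + A1 *ᵥ b n) →
      (∀ n, a n j = a 0 i) ∧ ∀ n, b n j = a 0 i := by
  obtain ⟨j, hj⟩ := h.max_principle
  refine ⟨j, fun a b i ha hb h1 h2 h3 h4 => ?_⟩
  have key := hj (glue a b) i (fun n k => ?_) (fun n => ?_)
  · exact ⟨fun n => key (Int.ofNat n), fun n => key (Int.negSucc n)⟩
  · cases n with
    | ofNat n => exact ha n k
    | negSucc n => exact hb n k
  · match n with
    | Int.ofNat 0 => exact h2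
    | Int.ofNat (n + 1) =>
      have e1 : Int.ofNat (n + 1) - 1 = Int.ofNat n := by simp
      have e2 : Int.ofNat (n + 1) + 1 = Int.ofNat (n + 2) := rfl
      rw [e1, e2]
      exact h1 n
    | Int.negSucc 0 => exact h3
    | Int.negSucc (n + 1) =>
      have e1 : Int.negSucc (n + 1) - 1 = Int.negSucc (n + 2) := rfl
      have e2 : Int.negSucc (n + 1) + 1 = Int.negSucc n := by
        simp only [Int.negSucc_eq]; push_cast; ring
      rw [e1, e2]
      exact h4 n

section

variable {Am A0 A1 G Gh R : Matrix (Fin m) (Fin m) ℝ} (h : Blocks Am A0 A1)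
  (hG : IsMinNonnegSol (fun X => Am + (A0 - 1) * X + A1 * X ^ 2) G)

include h in
-- Absolute values turn harmonic sequences into subharmonic ones, to which the maximum principle
-- applies.
theorem Blocks.abs_le_of_harmonic {x a b c : Fin m → ℝ}
    (hx : Am *ᵥ a + A0 *ᵥ b + A1 *ᵥ c = x) :
    (fun k => |x k|) ≤ Am *ᵥ (fun k => |a k|) + A0 *ᵥ (fun k => |b k|) + A1 *ᵥ (fun k => |c k|) := by
  intro k
  have h1 := h.Am_nonneg.abs_mulVec_le a k
  have h2 := h.A0_nonneg.abs_mulVec_le b k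
  have h3 := h.A1_nonneg.abs_mulVec_le c k
  rw [← hx]
  simp only [Pi.add_apply]
  exact (abs_add_three _ _ _).trans (by linarith)

include hG in
theorem IsMinNonnegSol.mulVec_pow_harmonic (v : Fin m → ℝ) (n : ℕ) :
    Am *ᵥ (G ^ n *ᵥ v) + A0 *ᵥ (G ^ (n + 1) *ᵥ v) + A1 *ᵥ (G ^ (n + 2) *ᵥ v) =
      G ^ (n + 1) *ᵥ v := by
  have e : Am * G ^ n + A0 * G ^ (n + 1) + A1 * G ^ (n + 2) = G ^ (n + 1) := by
    have := congrArg (fun X => X * G ^ n) hG.quadratic_eq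
    simp only [add_mul, mul_assoc, ← pow_succ', ← pow_add] at this
    rwa [add_comm 2 n] at this
  simp only [Matrix.mulVec_mulVec, ← Matrix.add_mulVec, e]

include hG in
theorem IsMinNonnegSol.one_sub_U_mul : (1 - (A0 + A1 * G)) * G = Am := by
  have := hG.quadratic_eq
  have e : (1 - (A0 + A1 * G)) * G = G - A0 * G - A1 * G ^ 2 := by noncomm_ring
  rw [e]
  nth_rw 1 [← this]
  abel

include h hG

theorem Blocks.U_nonneg : EntryNonneg (A0 + A1 * G) :=
  h.A0_nonneg.add (h.A1_nonneg.mul hG.1)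

theorem Blocks.U_mulVec_one_le : (A0 + A1 * G) *ᵥ 1 ≤ 1 := by
  rw [Matrix.add_mulVec, ← Matrix.mulVec_mulVec]
  have h1 := h.A1_nonneg.mulVec_mono (h.sol_mulVec_one_le hG)
  have h2 := h.Am_nonneg.mulVec_nonneg (u := 1) zero_le_one
  calc A0 *ᵥ 1 + A1 *ᵥ (G *ᵥ 1) ≤ A0 *ᵥ 1 + A1 *ᵥ 1 := by gcongr
    _ ≤ Am *ᵥ 1 + (A0 *ᵥ 1 + A1 *ᵥ 1) := le_add_of_nonneg_left h2
    _ = 1 := by rw [← add_assoc, h.row_sum]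

theorem Blocks.abs_pow_sol_le {v : Fin m → ℝ} {i : Fin m} (hi : ∀ k, |v k| ≤ |v i|) (n : ℕ)
    (k : Fin m) : |(G ^ n *ᵥ v) k| ≤ |v i| := by
  have hnn : EntryNonneg (G ^ n) := EntryNonneg.pow hG.1 n
  exact (hnn.abs_mulVec_le v k).trans (hnn.mulVec_le_const
    (EntryNonneg.pow_mulVec_one_le hG.1 (h.sol_mulVec_one_le hG) n) (abs_nonneg _) hi k)

/-- If Uv = v, then |Gⁿv| on the levels n ≥ 0, continued by zero below, is subharmonic with its
maximum on level 0. The maximum is also attained below level 0, so it is zero. -/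
theorem Blocks.isUnit_one_sub_U : IsUnit (1 - (A0 + A1 * G)) := by
  refine isUnit_one_sub_of_forall_mulVec fun v hv => ?_
  obtain ⟨j, hj⟩ := h.glue_max_principle
  have : Nonempty (Fin m) := ⟨j⟩
  obtain ⟨i, hi⟩ := Finite.exists_max fun k => |v k|
  have key := (hj (fun n k => |(G ^ n *ᵥ v) k|) 0 i (fun n k => ?_) (fun n k => ?_) (fun n => ?_)
    ?_ ?_ (fun n => ?_)).2 0
  · ext k
    have h0 := hi k
    simp only [pow_zero, Matrix.one_mulVec, Pi.zero_apply] at key h0 ⊢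
    rw [← key] at h0
    exact abs_nonpos_iff.1 h0
  · simpa using h.abs_pow_sol_le hG hi n k
  · exact abs_nonneg _
  · exact h.abs_le_of_harmonic (hG.mulVec_pow_harmonic v n)
  · have := h.abs_le_of_harmonic (x := v) (a := 0) (b := v) (c := G *ᵥ v) (by
      rw [Matrix.mulVec_zero, zero_add, Matrix.mulVec_mulVec, ← Matrix.add_mulVec, hv])
    have e : (Am *ᵥ fun _ => (0 : ℝ)) = 0 := Matrix.mulVec_zero Am
    simpa [e] using this
  · have := h.A1_nonneg.mulVec_nonneg (u := fun k => |v k|) (fun k => abs_nonneg _)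
    simpa using this
  · simp

variable (hR : IsMinNonnegSol (fun X => A1 + X * (A0 - 1) + X ^ 2 * Am) R)
include hR

/-- The relation between `R` and `G`. -/
theorem Blocks.R_mul : R * (1 - (A0 + A1 * G)) = A1 ∧ R * Am = A1 * G := by
  obtain ⟨Z, hZ⟩ := (h.isUnit_one_sub_U hG).exists_left_inv
  have hZ' := mul_eq_one_comm.1 hZ
  have hU := h.U_nonneg hG
  have hU1 := h.U_mulVec_one_le hG
  have hUb : ∀ n i j, ((A0 + A1 * G) ^ n) i j ≤ 1 := fun n i j =>
    ((hU.pow n).entry_le_mulVec_one i j).trans (hU.pow_mulVec_one_le hU1 n i)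
  have hZnn : EntryNonneg Z := hU.inv_one_sub_nonneg hUb hZ
  have hUG := hG.one_sub_U_mul
  -- With Z = (I - U)⁻¹ ≥ 0, the matrix A₁Z solves the equation of `R`. Minimality bounds `R`, and
  -- therefore A₀ + RA₋₁ ≤ U.
  have hle : ∀ i j, R i j ≤ (A1 * Z) i j := by
    refine hR.2.2 _ (h.A1_nonneg.mul hZnn) ?_
    have e1 : Z * Am = G := by rw [← hUG, ← mul_assoc, hZ, one_mul]
    calc A1 + A1 * Z * (A0 - 1) + (A1 * Z) ^ 2 * Am
        = A1 + A1 * Z * (A0 - 1) + A1 * Z * A1 * (Z * Am) := by noncomm_ring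
      _ = A1 - A1 * (Z * (1 - (A0 + A1 * G))) := by rw [e1]; noncomm_ring
      _ = 0 := by rw [hZ, mul_one, sub_self]
  have hRnn : EntryNonneg R := hR.1
  set U := A0 + A1 * G with hUdef
  have hU2 : EntryNonneg (A0 + R * Am) := h.A0_nonneg.add (hRnn.mul h.Am_nonneg)
  have hU2le : ∀ i j, (A0 + R * Am) i j ≤ U i j := fun i j => by
    have e1 : A1 * Z * Am = A1 * G := by rw [← hUG, ← mul_assoc, mul_assoc A1, hZ, mul_one]
    rw [hUdef, ← e1, Matrix.add_apply, Matrix.add_apply]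
    have := mul_entry_mono hRnn h.Am_nonneg hle (fun _ _ => le_rfl) i j
    linarith
  have hpow : ∀ n i j, ((A0 + R * Am) ^ n) i j ≤ (U ^ n) i j := fun n => by
    induction n with
    | zero => intro i j; simp
    | succ n ih =>
      intro i j
      rw [pow_succ, pow_succ]
      exact mul_entry_mono (hU2.pow n) hU2 ih hU2le i j
  have hlim : Tendsto (fun n => (A0 + R * Am) ^ n) atTop (𝓝 0) :=
    tendsto_pi_nhds.2 fun i => tendsto_pi_nhds.2 fun j =>
      squeeze_zero (fun n => hU2.pow n i j) (fun n => hpow n i j)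
        (hU.summable_pow hUb (h.isUnit_one_sub_U hG) i j).tendsto_atTop_zero
  obtain ⟨Z2, hZ2⟩ := (isUnit_one_sub_of_tendsto hlim).exists_left_inv
  have hZ2' := mul_eq_one_comm.1 hZ2
  have hZ2nn : EntryNonneg Z2 :=
    hU2.inv_one_sub_nonneg (fun n i j => (hpow n i j).trans (hUb n i j)) hZ2
  have hRU2 : R * (1 - (A0 + R * Am)) = A1 := by
    have h0 : A1 + R * (A0 - 1) + R ^ 2 * Am = 0 := hR.2.1
    rw [← sub_eq_zero, ← neg_eq_zero, ← h0]
    noncomm_ring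
  have hA1G2 : A1 * (Z2 * Am) = R * Am := by
    rw [← hRU2, mul_assoc, ← mul_assoc _ Z2, hZ2', one_mul]
  -- The converse comparison: with Z₂ = (I - A₀ - RA₋₁)⁻¹, the matrix Z₂A₋₁ solves the equation of
  -- `G`. This gives A₁G ≤ RA₋₁, hence equality.
  have hGle : ∀ i j, G i j ≤ (Z2 * Am) i j := by
    refine hG.2.2 _ (hZ2nn.mul h.Am_nonneg) ?_
    calc Am + (A0 - 1) * (Z2 * Am) + A1 * (Z2 * Am) ^ 2
        = Am + (A0 - 1) * (Z2 * Am) + A1 * (Z2 * Am) * (Z2 * Am) := by noncomm_ring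
      _ = Am - (1 - (A0 + R * Am)) * Z2 * Am := by rw [hA1G2]; noncomm_ring
      _ = 0 := by rw [hZ2', one_mul, sub_self]
  have hUU : A0 + R * Am = U := by
    ext i j
    refine le_antisymm (hU2le i j) ?_
    rw [hUdef, ← hA1G2, Matrix.add_apply, Matrix.add_apply]
    have := mul_entry_mono h.A1_nonneg hG.1 (fun _ _ => le_rfl) hGle i j
    linarith
  exact ⟨hUU ▸ hRU2, add_left_cancel (hUU.trans hUdef)⟩

omit hR
variable (hGh : IsMinNonnegSol (fun X => A1 + (A0 - 1) * X + Am * X ^ 2) Gh)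
include hGh

/-- If GĜv = v, gluing |Gⁿv| on levels n ≥ 0 to |Ĝⁿv| on levels -n gives a subharmonic function
whose maximum persists on all levels at one phase. Decay on either side forces it to be zero. -/
theorem Blocks.isUnit_one_sub_mul
    (hlim : Tendsto (fun n => G ^ n) atTop (𝓝 0) ∨ Tendsto (fun n => Gh ^ n) atTop (𝓝 0)) :
    IsUnit (1 - G * Gh) := by
  refine isUnit_one_sub_of_forall_mulVec fun v hv => ?_
  obtain ⟨j, hj⟩ := h.glue_max_principle
  have : Nonempty (Fin m) := ⟨j⟩
  obtain ⟨i, hi⟩ := Finite.exists_max fun k => |v k|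
  have key := hj (fun n k => |(G ^ n *ᵥ v) k|) (fun n k => |(Gh ^ (n + 1) *ᵥ v) k|) i
    (fun n k => ?_) (fun n k => ?_) (fun n => ?_) ?_ ?_ (fun n => ?_)
  · have hzero : ∀ {X : Matrix (Fin m) (Fin m) ℝ} {a : ℕ}, Tendsto (fun n => X ^ n) atTop (𝓝 0) →
        (∀ n, |(X ^ (n + a) *ᵥ v) j| = |(G ^ 0 *ᵥ v) i|) → v = 0 := by
      intro X a hX hk
      have h2 := (tendsto_mulVec hX (tendsto_const_nhds (x := v))).comp (tendsto_add_atTop_nat a)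
      rw [Matrix.zero_mulVec] at h2
      have h3 := (tendsto_pi_nhds.1 h2 j).abs
      simp only [Function.comp, hk, Pi.zero_apply, abs_zero, pow_zero, Matrix.one_mulVec] at h3
      have h4 := tendsto_nhds_unique tendsto_const_nhds h3
      ext k
      have h0 := hi k
      simp only [h4] at h0
      exact abs_nonpos_iff.1 h0
    rcases hlim with hl | hl
    · exact hzero (a := 0) hl key.1
    · exact hzero (a := 1) hl key.2
  · simpa using h.abs_pow_sol_le hG hi n k
  · simpa using h.swap.abs_pow_sol_le hGh hi (n + 1) k
  · exact h.abs_le_of_harmonic (hG.mulVec_pow_harmonic v n)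
  -- At level 0 the fixed-point property enters: A₋₁Ĝv = (I - U)GĜv = (I - U)v.
  · have := h.abs_le_of_harmonic (x := v) (a := Gh *ᵥ v) (b := v) (c := G *ᵥ v) (by
      rw [← hG.one_sub_U_mul, ← Matrix.mulVec_mulVec, Matrix.mulVec_mulVec (M := G), hv,
        Matrix.mulVec_mulVec, ← Matrix.add_mulVec, ← Matrix.add_mulVec, add_assoc,
        sub_add_cancel, Matrix.one_mulVec])
    simpa using this
  · have := h.abs_le_of_harmonic (x := Gh *ᵥ v) (a := Gh ^ 2 *ᵥ v) (b := Gh *ᵥ v) (c := v) (by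
      have := hGh.mulVec_pow_harmonic v 0
      simp only [pow_zero, zero_add, pow_one, Matrix.one_mulVec] at this
      exact Eq.trans (by abel) this)
    simpa using this
  · refine h.abs_le_of_harmonic ?_
    exact Eq.trans (by abel) (hGh.mulVec_pow_harmonic v (n + 1))

end

end QBD

namespace QBD

variable {m : ℕ}

/-! ### Convergence of the series `W` -/

theorem abs_mul_mul_apply_le (P Q X : Matrix (Fin m) (Fin m) ℝ) (hX : ∀ i j, |X i j| ≤ 1)
    (i j : Fin m) : |(P * X * Q) i j| ≤ ∑ i, ∑ j, ∑ l, ∑ k, |P i k| * |Q l j| := by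
  have h1 : |(P * X * Q) i j| ≤ ∑ l, ∑ k, |P i k| * |Q l j| := by
    rw [Matrix.mul_apply]
    refine (Finset.abs_sum_le_sum_abs _ _).trans (Finset.sum_le_sum fun l _ => ?_)
    rw [Matrix.mul_apply, Finset.sum_mul]
    refine (Finset.abs_sum_le_sum_abs _ _).trans (Finset.sum_le_sum fun k _ => ?_)
    rw [abs_mul, abs_mul]
    have := mul_le_mul_of_nonneg_left (hX k l) (abs_nonneg (P i k))
    rw [mul_one] at this
    exact mul_le_mul_of_nonneg_right this (abs_nonneg _)
  have h2 : ∀ i j, 0 ≤ ∑ l, ∑ k, |P i k| * |Q l j| := fun i j =>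
    Finset.sum_nonneg fun l _ => Finset.sum_nonneg fun k _ => by positivity
  refine h1.trans ?_
  refine (Finset.single_le_sum (f := fun j => ∑ l, ∑ k, |P i k| * |Q l j|)
    (fun j _ => h2 i j) (Finset.mem_univ j)).trans ?_
  exact Finset.single_le_sum (f := fun i => ∑ j, ∑ l, ∑ k, |P i k| * |Q l j|)
    (fun i _ => Finset.sum_nonneg fun j _ => h2 i j) (Finset.mem_univ i)

/-- A series `∑ Xⁿ C Yⁿ` converges when one of the two power series is summable and the other
one has bounded terms. -/
theorem summable_pow_mul_mul_pow {X Y : Matrix (Fin m) (Fin m) ℝ} (C : Matrix (Fin m) (Fin m) ℝ)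
    {b : ℝ} (hX : EntryNonneg X) (hY : EntryNonneg Y) (hXb : ∀ n i j, (X ^ n) i j ≤ b)
    (hYb : ∀ n i j, (Y ^ n) i j ≤ b)
    (hs : (∀ i j, Summable fun n => (X ^ n) i j) ∨ ∀ i j, Summable fun n => (Y ^ n) i j) :
    Summable fun n : ℕ => X ^ n * C * Y ^ n := by
  refine Pi.summable.2 fun i => Pi.summable.2 fun j => ?_
  simp only [Matrix.mul_apply, Finset.sum_mul]
  refine summable_sum fun l _ => summable_sum fun k _ => ?_
  rcases hs with hs | hs
  · refine Summable.of_norm_bounded ((hs i k).mul_right (|C k l| * b)) fun n => ?_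
    have h1 := hX.pow n i k
    have h2 := hY.pow n l j
    have h3 := hYb n l j
    rw [Real.norm_eq_abs, abs_mul, abs_mul, abs_of_nonneg h1, abs_of_nonneg h2, mul_assoc]
    exact mul_le_mul_of_nonneg_left (mul_le_mul_of_nonneg_left h3 (abs_nonneg _)) h1
  · refine Summable.of_norm_bounded ((hs l j).mul_left (b * |C k l|)) fun n => ?_
    have h1 := hX.pow n i k
    have h2 := hY.pow n l j
    have h3 := hXb n i k
    rw [Real.norm_eq_abs, abs_mul, abs_mul, abs_of_nonneg h1, abs_of_nonneg h2]
    exact mul_le_mul_of_nonneg_right (mul_le_mul_of_nonneg_right h3 (abs_nonneg _)) h2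

theorem tendsto_pow_mul_mul_pow {X Y : Matrix (Fin m) (Fin m) ℝ} (C : Matrix (Fin m) (Fin m) ℝ)
    {b : ℝ} (hX : EntryNonneg X) (hY : EntryNonneg Y) (hXb : ∀ n i j, (X ^ n) i j ≤ b)
    (hYb : ∀ n i j, (Y ^ n) i j ≤ b)
    (hs : (∀ i j, Summable fun n => (X ^ n) i j) ∨ ∀ i j, Summable fun n => (Y ^ n) i j) :
    Tendsto (fun n : ℕ => X ^ n * C * Y ^ n) atTop (𝓝 0) :=
  (summable_pow_mul_mul_pow C hX hY hXb hYb hs).tendsto_atTop_zero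

/-- Iterating the fixed-point equation telescopes the partial sums to D - XⁿDYⁿ. -/
theorem hasSum_of_fixed_point {X Y C D : Matrix (Fin m) (Fin m) ℝ}
    (hs : Summable fun n : ℕ => X ^ n * C * Y ^ n) (hfix : D = C + X * D * Y)
    (hD : Tendsto (fun n : ℕ => X ^ n * D * Y ^ n) atTop (𝓝 0)) :
    ∑' n : ℕ, X ^ n * C * Y ^ n = D := by
  have h1 : ∀ n, ∑ k ∈ Finset.range n, X ^ k * C * Y ^ k = D - X ^ n * D * Y ^ n := fun n => by
    induction n with
    | zero => simp
    | succ n ih =>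
      rw [Finset.sum_range_succ, ih]
      have : X ^ n * D * Y ^ n = X ^ n * C * Y ^ n + X ^ (n + 1) * D * Y ^ (n + 1) := by
        nth_rw 1 [hfix]
        rw [pow_succ, pow_succ']
        noncomm_ring
      rw [this]
      abel
  have h2 := hs.hasSum.tendsto_sum_nat
  simp only [h1] at h2
  have h3 := (tendsto_const_nhds (x := D)).sub hD
  rw [sub_zero] at h3
  exact tendsto_nhds_unique h2 h3

theorem exists_pow_bound {P Q X Y : Matrix (Fin m) (Fin m) ℝ} (hPQ : Q * P = 1)
    (hY : Y = P * X * Q) (hX : EntryNonneg X) (hXb : ∀ n i j, (X ^ n) i j ≤ 1) :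
    ∃ b, ∀ n i j, (Y ^ n) i j ≤ b := by
  have hpow : ∀ n, Y ^ n = P * X ^ n * Q := fun n => by
    induction n with
    | zero => simp [mul_eq_one_comm.1 hPQ]
    | succ n ih =>
      calc Y ^ (n + 1) = P * X ^ n * (Q * P) * X * Q := by rw [pow_succ, ih, hY]; noncomm_ring
        _ = P * X ^ (n + 1) * Q := by rw [hPQ, pow_succ]; noncomm_ring
  refine ⟨∑ i, ∑ j, ∑ l, ∑ k, |P i k| * |Q l j|, fun n i j => (le_abs_self _).trans ?_⟩
  rw [hpow]
  refine abs_mul_mul_apply_le P Q (X ^ n) (fun i j => ?_) i j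
  rw [abs_of_nonneg (hX.pow n i j)]
  exact hXb n i j

section

variable {Am A0 A1 G Gh R : Matrix (Fin m) (Fin m) ℝ} (h : Blocks Am A0 A1)
  (hG : IsMinNonnegSol (fun X => Am + (A0 - 1) * X + A1 * X ^ 2) G)
  (hGh : IsMinNonnegSol (fun X => A1 + (A0 - 1) * X + Am * X ^ 2) Gh)

include hG hGh in
-- Substituting A₋₁ = (I - U)G into the equation of Ĝ gives this intertwining relation, which makes
-- `R` similar to `Gh`.
theorem A1_mul_one_sub_mul :
    A1 * (1 - G * Gh) = (1 - (A0 + A1 * G)) * (1 - G * Gh) * Gh := by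
  have h1 := hG.one_sub_U_mul
  have h2 : A1 + (A0 - 1) * Gh + Am * Gh ^ 2 = 0 := hGh.2.1
  rw [← sub_eq_zero, ← h2]
  nth_rw 1 [← h1]
  noncomm_ring

include h hG hGh

theorem Blocks.W_spec (hR : IsMinNonnegSol (fun X => A1 + X * (A0 - 1) + X ^ 2 * Am) R)
    (hlim : Tendsto (fun n => G ^ n) atTop (𝓝 0) ∨ Tendsto (fun n => Gh ^ n) atTop (𝓝 0)) :
    IsUnit (A0 + R * Am - 1) ∧ Summable (Wterm Am A0 G R) ∧
      (Am * Gh + (A0 - 1) + A1 * G) * W Am A0 G R = 1 := by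
  obtain ⟨hR1, hR2⟩ := h.R_mul hG hR
  obtain ⟨Z, hZ⟩ := (h.isUnit_one_sub_U hG).exists_left_inv
  have hZ' := mul_eq_one_comm.1 hZ
  have hN := h.isUnit_one_sub_mul hG hGh hlim
  obtain ⟨N', hN'⟩ := hN.exists_left_inv
  have hN'' := mul_eq_one_comm.1 hN'
  have hUG := hG.one_sub_U_mul
  have hA1 := A1_mul_one_sub_mul hG hGh
  have hUR : A0 + R * Am - 1 = -(1 - (A0 + A1 * G)) := by rw [hR2]; abel
  set V := 1 - (A0 + A1 * G) with hV
  set N := 1 - G * Gh with hNdef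
  have hinv : (A0 + R * Am - 1)⁻¹ = -Z := by
    rw [hUR]
    exact Matrix.inv_eq_left_inv (by rw [neg_mul_neg, hZ])
  have hRZ : R = A1 * Z := by rw [← hR1, mul_assoc, hZ', mul_one]
  have hA1' : A1 = V * N * Gh * N' := by rw [← hA1, mul_assoc, hN'', mul_one]
  have hsim : R = (V * N) * Gh * (N' * Z) := by
    rw [hRZ, hA1', mul_assoc]
  have hQP : N' * Z * (V * N) = 1 := by
    rw [mul_assoc, ← mul_assoc Z, hZ, one_mul, hN']
  obtain ⟨b, hb⟩ := exists_pow_bound hQP hsim hGh.1 (h.swap.pow_sol_le_one hGh)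
  have hGnn : EntryNonneg G := hG.1
  have hRnn : EntryNonneg R := hR.1
  have hGb : ∀ n i j, (G ^ n) i j ≤ max b 1 := fun n i j =>
    (h.pow_sol_le_one hG n i j).trans (le_max_right _ _)
  have hRb : ∀ n i j, (R ^ n) i j ≤ max b 1 := fun n i j => (hb n i j).trans (le_max_left _ _)
  have hs : (∀ i j, Summable fun n => (G ^ n) i j) ∨ ∀ i j, Summable fun n => (R ^ n) i j := by
    rcases hlim with hl | hl
    · exact Or.inl (hGnn.summable_pow hGb (isUnit_one_sub_of_tendsto hl))
    -- Boundedness of Rⁿ and invertibility of I - R are inherited from Ĝ by similarity.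
    · refine Or.inr (hRnn.summable_pow hRb ?_)
      have e : 1 - R = (V * N) * (1 - Gh) * (N' * Z) := by
        rw [mul_sub, sub_mul, ← hsim, mul_one, mul_eq_one_comm.1 hQP]
      rw [e]
      exact ((IsUnit.of_mul_eq_one_right _ hQP).mul (isUnit_one_sub_of_tendsto hl)).mul
        (IsUnit.of_mul_eq_one _ hQP)
  have hsum : Summable (Wterm Am A0 G R) :=
    summable_pow_mul_mul_pow _ hGnn hRnn hGb hRb hs
  have hfix : -(N' * Z) = -Z + G * -(N' * Z) * R := by
    have e : G * (N' * Z) * R = N' * Z - Z := by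
      calc G * (N' * Z) * R = G * (N' * Z * (V * N)) * Gh * (N' * Z) := by
            nth_rw 1 [hsim]; noncomm_ring
        _ = (1 - N) * (N' * Z) := by rw [hQP, mul_one, hNdef, sub_sub_cancel]
        _ = N' * Z - N * N' * Z := by noncomm_ring
        _ = N' * Z - Z := by rw [hN'', one_mul]
    rw [mul_neg, neg_mul, e]
    abel
  have hW : W Am A0 G R = -(N' * Z) := by
    unfold W Wterm
    rw [hinv]
    refine hasSum_of_fixed_point ?_ hfix (tendsto_pow_mul_mul_pow _ hGnn hRnn hGb hRb hs)
    exact summable_pow_mul_mul_pow _ hGnn hRnn hGb hRb hs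
  refine ⟨?_, hsum, ?_⟩
  · rw [hUR]
    exact (h.isUnit_one_sub_U hG).neg
  · have e : Am * Gh + (A0 - 1) + A1 * G = -(V * N) := by
      rw [← hUG, hNdef, hV]; noncomm_ring
    rw [hW, e, neg_mul_neg, mul_eq_one_comm.1 hQP]

end

end QBD

namespace QBD

variable {m : ℕ}

/-! ### Drift -/

theorem mulVec_le_of_stochastic {X : Matrix (Fin m) (Fin m) ℝ} (hX : EntryNonneg X)
    (h1 : X *ᵥ 1 = 1) {v : Fin m → ℝ} {c : ℝ} (hv : ∀ i, v i ≤ c) (i : Fin m) :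
    (X *ᵥ v) i ≤ c := by
  have h := hX.mulVec_mono (u := v) (v := c • 1) (fun i => by simpa using hv i) i
  rw [Matrix.mulVec_smul, h1] at h
  simpa using h

theorem le_mulVec_of_stochastic {X : Matrix (Fin m) (Fin m) ℝ} (hX : EntryNonneg X)
    (h1 : X *ᵥ 1 = 1) {v : Fin m → ℝ} {c : ℝ} (hv : ∀ i, c ≤ v i) (i : Fin m) :
    c ≤ (X *ᵥ v) i := by
  have h := hX.mulVec_mono (u := c • 1) (v := v) (fun i => by simpa using hv i) i
  rw [Matrix.mulVec_smul, h1] at h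
  simpa using h

section

variable {Am A0 A1 G Gh R : Matrix (Fin m) (Fin m) ℝ} (h : Blocks Am A0 A1)
include h

theorem Blocks.phase_nonneg : EntryNonneg (Am + A0 + A1) :=
  (h.Am_nonneg.add h.A0_nonneg).add h.A1_nonneg

theorem Blocks.phase_mulVec_one : (Am + A0 + A1) *ᵥ 1 = 1 := by
  rw [Matrix.add_mulVec, Matrix.add_mulVec, h.row_sum]

/-- There are a drift `μ` and a correction `β` for which `(n, i) ↦ n + β i` increases by exactly
`μ` per step, in the mean. -/
theorem Blocks.exists_drift : ∃ (β : Fin m → ℝ) (μ : ℝ), ∀ i,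
    (Am *ᵥ β) i + (A0 *ᵥ β) i + (A1 *ᵥ β) i + (A1 *ᵥ 1) i - (Am *ᵥ 1) i = β i + μ := by
  obtain ⟨i₀, -⟩ := h.max_principle
  have : Nonempty (Fin m) := ⟨i₀⟩
  -- I minus the phase matrix kills constants; adding v(i₀)·1 makes it injective, hence surjective.
  -- The added term becomes the drift μ = β(i₀).
  let Ψ : (Fin m → ℝ) →ₗ[ℝ] (Fin m → ℝ) :=
    Matrix.mulVecLin (1 - (Am + A0 + A1)) +
      (LinearMap.proj i₀ : (Fin m → ℝ) →ₗ[ℝ] ℝ).smulRight (1 : Fin m → ℝ)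
  have hΨ : ∀ v i, Ψ v i = v i - ((Am + A0 + A1) *ᵥ v) i + v i₀ := fun v i => by
    simp [Ψ, Matrix.add_mulVec]
  have hinj : Function.Injective Ψ := by
    rw [injective_iff_map_eq_zero]
    intro v hv
    have hv' : ∀ i, v i - ((Am + A0 + A1) *ᵥ v) i + v i₀ = 0 := fun i => by
      rw [← hΨ, hv, Pi.zero_apply]
    obtain ⟨i, hi⟩ := Finite.exists_max v
    obtain ⟨i', hi'⟩ := Finite.exists_min v
    have h1 := mulVec_le_of_stochastic h.phase_nonneg h.phase_mulVec_one hi i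
    have h2 := le_mulVec_of_stochastic h.phase_nonneg h.phase_mulVec_one hi' i'
    have h0 : v i₀ = 0 := by linarith [hv' i, hv' i']
    have h3 : Am *ᵥ v + A0 *ᵥ v + A1 *ᵥ v = v := by
      ext k
      have := hv' k
      rw [h0, Matrix.add_mulVec, Matrix.add_mulVec] at this
      linarith
    obtain ⟨c, hc⟩ := h.const_of_harmonic h3
    ext k
    rw [hc, ← hc i₀, h0, Pi.zero_apply]
  obtain ⟨β, hβ⟩ := LinearMap.injective_iff_surjective.1 hinj (A1 *ᵥ 1 - Am *ᵥ 1)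
  refine ⟨β, β i₀, fun i => ?_⟩
  have := congrFun hβ i
  rw [hΨ, Matrix.add_mulVec, Matrix.add_mulVec] at this
  simp only [Pi.add_apply, Pi.sub_apply] at this
  linarith

section

variable {β : Fin m → ℝ} {μ : ℝ}
  (hβ : ∀ i, (Am *ᵥ β) i + (A0 *ᵥ β) i + (A1 *ᵥ β) i + (A1 *ᵥ 1) i - (Am *ᵥ 1) i = β i + μ)
include hβ

/-- If the process reaches higher levels almost surely, the drift is nonnegative. -/
theorem Blocks.drift_nonneg (hGh : IsMinNonnegSol (fun X => A1 + (A0 - 1) * X + Am * X ^ 2) Gh)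
    (h1 : Gh *ᵥ 1 = 1) : 0 ≤ μ := by
  by_contra hμ
  rw [not_le] at hμ
  obtain ⟨i₀, -⟩ := h.max_principle
  have : Nonempty (Fin m) := ⟨i₀⟩
  -- The last expression, times ε, is the exact gap in the supersolution inequality `hsuper` for v =
  -- 1 + εβ. Its leading term -μ is positive.
  have hev : ∀ᶠ ε : ℝ in 𝓝[>] 0, 0 < ε ∧ ∀ i, 0 < 1 + ε * β i ∧
      0 < -μ + ε * (β i - (A0 *ᵥ β) i - 2 * (A1 *ᵥ β) i - (A1 *ᵥ 1) i - ε * (A1 *ᵥ β) i) := by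
    refine (eventually_mem_nhdsWithin).and (eventually_all.2 fun i => ?_)
    refine Filter.Eventually.filter_mono nhdsWithin_le_nhds ?_
    refine Filter.Eventually.and ?_ ?_
    · have : Continuous fun ε : ℝ => 1 + ε * β i := by fun_prop
      exact this.tendsto 0 |>.eventually_const_lt (by simp)
    · have : Continuous fun ε : ℝ => -μ + ε * (β i - (A0 *ᵥ β) i - 2 * (A1 *ᵥ β) i -
        (A1 *ᵥ 1) i - ε * (A1 *ᵥ β) i) := by fun_prop
      exact this.tendsto 0 |>.eventually_const_lt (by simpa using hμ)
  obtain ⟨ε, hε, hall⟩ := hev.exists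
  set v : Fin m → ℝ := 1 + ε • β with hv
  have hvi : ∀ i, v i = 1 + ε * β i := fun i => by simp [hv]
  have hz : 0 < 1 + ε := by linarith
  have hXv : ∀ (X : Matrix (Fin m) (Fin m) ℝ) i,
      (X *ᵥ v) i = (X *ᵥ 1) i + ε * (X *ᵥ β) i := fun X i => by
    simp [hv, Matrix.mulVec_add, Matrix.mulVec_smul]
  -- Equivalently, (n, i) ↦ (1 + ε)ⁿ vᵢ is superharmonic. Induction then gives (1 + ε)Ĝv ≤ v, which
  -- fails at the positive minimum of `v` when Ĝ is stochastic.
  have hsuper : ∀ i, (1 + ε) ^ 2 * (A1 *ᵥ v) i + (1 + ε) * (A0 *ᵥ v) i + (Am *ᵥ v) i ≤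
      (1 + ε) * v i := fun i => by
    have e1 := hβ i
    have e2 := congrFun h.row_sum i
    simp only [Pi.add_apply, Pi.one_apply] at e2
    have e3 := mul_pos hε (hall i).2
    rw [hXv, hXv, hXv, hvi]
    have e4 : (1 + ε) * (1 + ε * β i) - ((1 + ε) ^ 2 * ((A1 *ᵥ 1) i + ε * (A1 *ᵥ β) i) +
        (1 + ε) * ((A0 *ᵥ 1) i + ε * (A0 *ᵥ β) i) + ((Am *ᵥ 1) i + ε * (Am *ᵥ β) i)) =
        ε * (-μ + ε * (β i - (A0 *ᵥ β) i - 2 * (A1 *ᵥ β) i - (A1 *ᵥ 1) i - ε * (A1 *ᵥ β) i)) := by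
      linear_combination (-ε) * e1 - (1 + ε) * e2
    linarith
  have hiter : ∀ k, (1 + ε) • (solIter A1 A0 Am k *ᵥ v) ≤ v := fun k => by
    induction k with
    | zero =>
      intro i
      simpa [solIter, hvi] using (hall i).1.le
    | succ k ih =>
      have hX := h.swap.solIter_nonneg k
      set X := solIter A1 A0 Am k
      have i1 := h.A0_nonneg.mulVec_mono ih
      have i2 := h.Am_nonneg.mulVec_mono ih
      have i3 := (h.Am_nonneg.mul hX).mulVec_mono ih
      intro i
      have j1 := i1 i
      have j2 := i2 i
      have j3 := i3 i
      have j4 := hsuper i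
      simp only [Matrix.mulVec_smul, Pi.smul_apply, smul_eq_mul, ← Matrix.mulVec_mulVec]
        at j1 j2 j3
      simp only [solIter, Matrix.add_mulVec, ← Matrix.mulVec_mulVec, pow_two, Pi.smul_apply,
        Pi.add_apply, smul_eq_mul]
      refine le_of_mul_le_mul_left ?_ hz
      nlinarith [mul_le_mul_of_nonneg_left j1 hz.le, mul_le_mul_of_nonneg_left j3 hz.le]
  have hlim : (1 + ε) • (Gh *ᵥ v) ≤ v :=
    le_of_tendsto' ((tendsto_mulVec (h.swap.tendsto_solIter hGh) tendsto_const_nhds).const_smul _)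
      hiter
  obtain ⟨i, hi⟩ := Finite.exists_min v
  have k1 := le_mulVec_of_stochastic hGh.1 h1 hi i
  have k2 := hlim i
  have k3 := (hall i).1
  rw [← hvi] at k3
  simp only [Pi.smul_apply, smul_eq_mul] at k2
  nlinarith

variable (hG : IsMinNonnegSol (fun X => Am + (A0 - 1) * X + A1 * X ^ 2) G)
include hG

/-- If lower levels are reached almost surely, in finite mean time, the drift is negative. -/
theorem Blocks.drift_neg (h1 : G *ᵥ 1 = 1) {θ : Fin m → ℝ} (hθ0 : 0 ≤ θ)
    (hθ : θ = 1 + A0 *ᵥ θ + A1 *ᵥ (θ + G *ᵥ θ)) : μ < 0 := by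
  by_contra hμ
  rw [not_lt] at hμ
  obtain ⟨i₀, -⟩ := h.max_principle
  have : Nonempty (Fin m) := ⟨i₀⟩
  have hθi : ∀ i, θ i = 1 + ((A0 + A1 * G) *ᵥ θ) i + (A1 *ᵥ θ) i := fun i => by
    have := congrFun hθ i
    simp only [Pi.add_apply, Matrix.mulVec_add, Pi.one_apply, Matrix.add_mulVec,
      ← Matrix.mulVec_mulVec] at this ⊢
    linarith
  have hUnn := h.U_nonneg hG
  have hθpos : ∀ i, 0 < θ i := fun i => by
    have k1 := hUnn.mulVec_nonneg hθ0 i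
    have k2 := h.A1_nonneg.mulVec_nonneg hθ0 i
    simp only [Pi.zero_apply] at k1 k2
    linarith [hθi i]
  -- The mean decrease of n + βᵢ over a descent by one level; optional stopping suggests w = -μθ.
  set w : Fin m → ℝ := 1 + β - G *ᵥ β with hw
  have hUw : ∀ i, ((A0 + A1 * G) *ᵥ w) i + (A1 *ᵥ w) i = w i + μ := fun i => by
    have e1 := hβ i
    have e2 := congrFun h.row_sum i
    have e3 := congrFun (congrArg (fun X => X *ᵥ β) hG.quadratic_eq) i
    simp only [Pi.add_apply, Pi.one_apply, Matrix.add_mulVec, pow_two, ← Matrix.mulVec_mulVec]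
      at e2 e3
    simp only [hw, Matrix.mulVec_add, Matrix.mulVec_sub, Matrix.add_mulVec,
      ← Matrix.mulVec_mulVec, Pi.add_apply, Pi.sub_apply, h1, Pi.one_apply]
    linarith
  -- If r = max w/θ were positive, comparing the equations of `w` and rθ at the maximizer would give
  -- μ ≤ -r < 0.
  obtain ⟨i, hi⟩ := Finite.exists_max fun k => w k / θ k
  have hwle : ∀ k, w k ≤ 0 := by
    intro k
    by_contra hk
    rw [not_le] at hk
    have hr : 0 < w i / θ i := lt_of_lt_of_le (div_pos hk (hθpos k)) (hi k)
    set r := w i / θ i with hrdef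
    have hwr : w ≤ r • θ := fun l => by
      simpa using (div_le_iff₀ (hθpos l)).1 (hi l)
    have hwi : w i = r * θ i := by rw [hrdef, div_mul_cancel₀ _ (hθpos i).ne']
    have k1 := hUnn.mulVec_mono hwr i
    have k2 := h.A1_nonneg.mulVec_mono hwr i
    simp only [Matrix.mulVec_smul, Pi.smul_apply, smul_eq_mul] at k1 k2
    have k3 := hUw i
    have k4 : r * θ i = r + r * ((A0 + A1 * G) *ᵥ θ) i + r * (A1 *ᵥ θ) i := by
      nth_rw 1 [hθi i]; ring
    linarith
  -- Where β is maximal, Gβ ≤ β because `G` is stochastic, so w ≥ 1 there.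
  obtain ⟨l, hl⟩ := Finite.exists_max β
  have k1 := mulVec_le_of_stochastic hG.1 h1 hl l
  have k2 := hwle l
  simp only [hw, Pi.add_apply, Pi.sub_apply, Pi.one_apply] at k2
  linarith

end

/-- Approximations from below of the mean time to go down one level. -/
noncomputable def timeIter (Am A0 A1 : Matrix (Fin m) (Fin m) ℝ) : ℕ → Fin m → ℝ
  | 0 => 0
  | k + 1 => 1 + A0 *ᵥ timeIter Am A0 A1 k +
      A1 *ᵥ (timeIter Am A0 A1 k + solIter Am A0 A1 k *ᵥ timeIter Am A0 A1 k)

theorem Blocks.timeIter_nonneg (k : ℕ) : 0 ≤ timeIter Am A0 A1 k := by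
  induction k with
  | zero => exact le_rfl
  | succ k ih =>
    exact add_nonneg (add_nonneg zero_le_one (h.A0_nonneg.mulVec_nonneg ih))
      (h.A1_nonneg.mulVec_nonneg (add_nonneg ih ((h.solIter_nonneg k).mulVec_nonneg ih)))

theorem Blocks.timeIter_mono (k : ℕ) : timeIter Am A0 A1 k ≤ timeIter Am A0 A1 (k + 1) := by
  induction k with
  | zero => exact h.timeIter_nonneg 1
  | succ k ih =>
    refine add_le_add (add_le_add le_rfl (h.A0_nonneg.mulVec_mono ih))
      (h.A1_nonneg.mulVec_mono (add_le_add ih ?_))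
    refine ((h.solIter_nonneg k).mulVec_mono ih).trans fun i => ?_
    rw [mulVec_apply, mulVec_apply]
    exact Finset.sum_le_sum fun l _ =>
      mul_le_mul_of_nonneg_right (h.solIter_mono k i l) (h.timeIter_nonneg (k + 1) l)

/-- Any supersolution τ of the mean-time equations dominates the truncated descent time plus the
time still needed one level below; this keeps the approximations bounded. -/
theorem Blocks.timeIter_le {τ : ℕ → Fin m → ℝ} (hτ0 : ∀ n, 0 ≤ τ n)
    (hτ : ∀ n, 1 + Am *ᵥ τ n + A0 *ᵥ τ (n + 1) + A1 *ᵥ τ (n + 2) ≤ τ (n + 1)) (k n : ℕ) :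
    timeIter Am A0 A1 k + solIter Am A0 A1 k *ᵥ τ n ≤ τ (n + 1) := by
  induction k generalizing n with
  | zero => simpa [timeIter, solIter] using hτ0 (n + 1)
  | succ k ih =>
    refine le_trans ?_ (hτ n)
    have hX := h.solIter_nonneg k
    have i1 := h.A0_nonneg.mulVec_mono (ih n)
    have i2 := h.A1_nonneg.mulVec_mono
      ((add_le_add (le_refl (timeIter Am A0 A1 k)) (hX.mulVec_mono (ih n))).trans (ih (n + 1)))
    intro i
    have j1 := i1 i
    have j2 := i2 i
    simp only [timeIter, solIter, Matrix.add_mulVec, Matrix.mulVec_add, pow_two,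
      ← Matrix.mulVec_mulVec, Pi.add_apply] at j1 j2 ⊢
    linarith

variable (hG : IsMinNonnegSol (fun X => Am + (A0 - 1) * X + A1 * X ^ 2) G)
include hG

theorem Blocks.exists_mean_time {τ : ℕ → Fin m → ℝ} (hτ0 : ∀ n, 0 ≤ τ n)
    (hτ : ∀ n, 1 + Am *ᵥ τ n + A0 *ᵥ τ (n + 1) + A1 *ᵥ τ (n + 2) ≤ τ (n + 1)) :
    ∃ θ : Fin m → ℝ, 0 ≤ θ ∧ θ = 1 + A0 *ᵥ θ + A1 *ᵥ (θ + G *ᵥ θ) := by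
  have hb : ∀ k, timeIter Am A0 A1 k ≤ τ 1 := fun k =>
    le_trans (le_add_of_nonneg_right ((h.solIter_nonneg k).mulVec_nonneg (hτ0 0)))
      (h.timeIter_le hτ0 hτ k 0)
  have hex : ∀ i, ∃ l, Tendsto (fun k => timeIter Am A0 A1 k i) atTop (𝓝 l) := fun i =>
    ⟨_, tendsto_atTop_ciSup (monotone_nat_of_le_succ fun k => h.timeIter_mono k i)
      ⟨τ 1 i, by rintro _ ⟨k, rfl⟩; exact hb k i⟩⟩
  choose θ hθ using hex
  have hθ' : Tendsto (timeIter Am A0 A1) atTop (𝓝 θ) := tendsto_pi_nhds.2 hθ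
  refine ⟨θ, ge_of_tendsto' hθ' fun k => h.timeIter_nonneg k, ?_⟩
  refine tendsto_nhds_unique (hθ'.comp (tendsto_add_atTop_nat 1)) ?_
  exact (tendsto_const_nhds.add (tendsto_mulVec tendsto_const_nhds hθ')).add
    (tendsto_mulVec tendsto_const_nhds
      (hθ'.add (tendsto_mulVec (h.tendsto_solIter hG) hθ')))

/-- If the mean time to go down one level is finite, it is impossible that lower levels and higher
levels are both reached almost surely. -/
theorem Blocks.not_both_stochastic_of_mean_time
    (hGh : IsMinNonnegSol (fun X => A1 + (A0 - 1) * X + Am * X ^ 2) Gh)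
    {τ : ℕ → Fin m → ℝ} (hτ0 : ∀ n, 0 ≤ τ n)
    (hτ : ∀ n, 1 + Am *ᵥ τ n + A0 *ᵥ τ (n + 1) + A1 *ᵥ τ (n + 2) ≤ τ (n + 1)) :
    ¬ (G *ᵥ 1 = 1 ∧ Gh *ᵥ 1 = 1) := by
  rintro ⟨h1, h2⟩
  obtain ⟨β, μ, hβ⟩ := h.exists_drift
  obtain ⟨θ, hθ0, hθ⟩ := h.exists_mean_time hG hτ0 hτ
  exact absurd (h.drift_neg hβ hG h1 hθ0 hθ) (not_lt.2 (h.drift_nonneg hβ hGh h2))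

/-- A bounded function that is subharmonic off level `0` is bounded by the mean of its values one
level below, if that level is reached almost surely. -/
theorem Blocks.le_mulVec_of_subharmonic (h1 : G *ᵥ 1 = 1) {e : ℕ → Fin m → ℝ} {c : ℝ}
    (he : ∀ n i, e n i ≤ c)
    (hsub : ∀ n, e (n + 1) ≤ Am *ᵥ e n + A0 *ᵥ e (n + 1) + A1 *ᵥ e (n + 2)) (n : ℕ) :
    e (n + 1) ≤ G *ᵥ e n := by
  -- The truncated descent misses mass 1 - Xₖ1, on which `e` is bounded by `c`. This error vanishes
  -- in the limit because `G` is stochastic.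
  have key : ∀ k n, e (n + 1) ≤ solIter Am A0 A1 k *ᵥ e n +
      c • (1 - solIter Am A0 A1 k *ᵥ (1 : Fin m → ℝ)) := by
    intro k
    induction k with
    | zero => intro n i; simpa [solIter] using he (n + 1) i
    | succ k ih =>
      intro n
      have hX := h.solIter_nonneg k
      set X := solIter Am A0 A1 k with hXdef
      have i0 : e (n + 2) ≤ X *ᵥ (X *ᵥ e n) + c • (1 - X *ᵥ (X *ᵥ (1 : Fin m → ℝ))) := by
        refine (ih (n + 1)).trans ?_
        have := hX.mulVec_mono (ih n)
        intro i
        have hi := this i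
        simp only [Matrix.mulVec_add, Matrix.mulVec_sub, Matrix.mulVec_smul, Pi.add_apply,
          Pi.smul_apply, Pi.sub_apply, smul_eq_mul, Pi.one_apply] at hi ⊢
        linarith
      have i1 := h.A0_nonneg.mulVec_mono (ih n)
      have i2 := h.A1_nonneg.mulVec_mono i0
      intro i
      have j0 := hsub n i
      have j1 := i1 i
      have j2 := i2 i
      have j3 := congrFun h.row_sum i
      simp only [solIter, ← hXdef, Matrix.add_mulVec, Matrix.mulVec_add, Matrix.mulVec_sub,
        Matrix.mulVec_smul, pow_two, ← Matrix.mulVec_mulVec, Pi.add_apply, Pi.smul_apply,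
        Pi.sub_apply, smul_eq_mul, Pi.one_apply] at j0 j1 j2 j3 ⊢
      have j4 : c * ((Am *ᵥ 1) i + (A0 *ᵥ 1) i + (A1 *ᵥ 1) i) = c := by rw [j3, mul_one]
      linarith
  have hlim := (tendsto_mulVec (h.tendsto_solIter hG) (tendsto_const_nhds (x := e n))).add
    (((tendsto_const_nhds (x := (1 : Fin m → ℝ))).sub
      (tendsto_mulVec (h.tendsto_solIter hG) (tendsto_const_nhds (x := (1 : Fin m → ℝ))))).const_smul c)
  rw [h1, sub_self, smul_zero, add_zero] at hlim
  exact ge_of_tendsto' hlim fun k => key k n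

end

end QBD

namespace QBD

/-! ### Hitting probabilities and mean hitting times -/

section Chain

variable {S : Type*}

theorem eq_of_tsum_mul_le {a f : S → ℝ≥0∞} {c : ℝ≥0∞} (ha : ∑' u, a u = 1) (hc : c ≠ ⊤)
    (hf : ∀ u, c ≤ f u) (hle : ∑' u, a u * f u ≤ c) {u : S} (hu : a u ≠ 0) : f u = c := by
  by_contra hne
  have hau : a u ≠ ⊤ := ((ENNReal.le_tsum u).trans (ha.le)).trans_lt ENNReal.one_lt_top |>.ne
  have hsum : ∑' u, a u * c = c := by rw [ENNReal.tsum_mul_right, ha, one_mul]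
  have := ENNReal.tsum_lt_tsum (f := fun u => a u * c) (g := fun u => a u * f u) (i := u)
    (by rw [hsum]; exact hc) (fun u => mul_le_mul_right (hf u) _)
    (ENNReal.mul_lt_mul_right hu hau (lt_of_le_of_ne (hf u) (Ne.symm hne)))
  rw [hsum] at this
  exact absurd hle (not_le.2 this)

theorem eq_one_of_one_le_tsum_mul {a f : S → ℝ≥0∞} (ha : ∑' u, a u = 1)
    (hf : ∀ u, f u ≤ 1) (hle : 1 ≤ ∑' u, a u * f u) {u : S} (hu : a u ≠ 0) : f u = 1 := by
  by_contra hne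
  have hau : a u ≠ ⊤ := ((ENNReal.le_tsum u).trans (ha.le)).trans_lt ENNReal.one_lt_top |>.ne
  have hb : ∀ u, a u * f u ≤ a u := fun u => by
    simpa using mul_le_mul_right (hf u) (a u)
  have := ENNReal.tsum_lt_tsum (f := fun u => a u * f u) (g := a) (i := u)
    (((ENNReal.tsum_le_tsum hb).trans ha.le).trans_lt ENNReal.one_lt_top).ne hb
    (by simpa using ENNReal.mul_lt_mul_right hu hau (lt_of_le_of_ne (hf u) hne))
  rw [ha] at this
  exact absurd hle (not_le.2 this)

theorem IsIrreducible.propagate {P : Matrix S S ℝ} (hP : P.IsIrreducible) (p : S → Prop)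
    (hp : ∀ s u, 0 < P s u → p s → p u) {s : S} (hs : p s) (u : S) : p u := by
  let _ := Matrix.toQuiver P
  obtain ⟨path, -⟩ := hP.connected s u
  clear hP
  induction path with
  | nil => exact hs
  | cons _ e ih => exact hp _ _ e.down ih

/-! ### First-step analysis of visits to a fixed state -/

variable [DecidableEq S] (P : Matrix S S ℝ) (t : S)

/-- Probability of visiting `t` at some time `≥ 0`, from `s`. -/
noncomputable def visitProb (s : S) : ℝ≥0∞ :=
  if s = t then 1 else ∑' n, firstPassage P t n s

/-- Mean time until the first visit to `t` (at a time `≥ 0`), from `s`, if this visit is almost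
sure. -/
noncomputable def visitTime (s : S) : ℝ≥0∞ :=
  if s = t then 0 else ∑' n : ℕ, ((n : ℝ≥0∞) + 1) * firstPassage P t n s

theorem tsum_firstPassage_succ (c : ℕ → ℝ≥0∞) (s : S) :
    ∑' n, c n * firstPassage P t (n + 1) s =
      ∑' u, if u = t then 0 else ENNReal.ofReal (P s u) * ∑' n, c n * firstPassage P t n u := by
  simp only [firstPassage, ← ENNReal.tsum_mul_left]
  rw [ENNReal.tsum_comm]
  refine tsum_congr fun u => ?_
  split_ifs
  · simp
  · exact tsum_congr fun n => mul_left_comm _ _ _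

/-- First-step analysis. The left side counts times ≥ 1 and `visitProb` times ≥ 0, so for `s = t`
this is the return probability and otherwise harmonicity at `s`. -/
theorem tsum_firstPassage (s : S) :
    ∑' n, firstPassage P t n s = ∑' u, ENNReal.ofReal (P s u) * visitProb P t u := by
  rw [tsum_eq_zero_add' ENNReal.summable,
    ENNReal.tsum_eq_add_tsum_ite (f := fun u => ENNReal.ofReal (P s u) * visitProb P t u) t]
  have h1 := tsum_firstPassage_succ P t (fun _ => 1) s
  simp only [one_mul] at h1
  rw [h1]
  congr 1
  · simp [firstPassage, visitProb]
  · refine tsum_congr fun u => ?_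
    split_ifs with hu
    · rfl
    · simp [visitProb, hu]

theorem tsum_mul_firstPassage (s : S) :
    ∑' n : ℕ, ((n : ℝ≥0∞) + 1) * firstPassage P t n s =
      ∑' n, firstPassage P t n s + ∑' u, ENNReal.ofReal (P s u) * visitTime P t u := by
  have h1 : ∑' n : ℕ, ((n : ℝ≥0∞) + 1) * firstPassage P t n s =
      ∑' n, firstPassage P t n s + ∑' n : ℕ, (n : ℝ≥0∞) * firstPassage P t n s := by
    rw [← ENNReal.tsum_add]
    exact tsum_congr fun n => by ring
  rw [h1]
  congr 1
  rw [tsum_eq_zero_add' ENNReal.summable,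
    ENNReal.tsum_eq_add_tsum_ite (f := fun u => ENNReal.ofReal (P s u) * visitTime P t u) t]
  have h2 := tsum_firstPassage_succ P t (fun n => (n : ℝ≥0∞) + 1) s
  simp only [Nat.cast_add, Nat.cast_one, h2]
  congr 1
  · simp [visitTime]
  · refine tsum_congr fun u => ?_
    split_ifs with hu
    · rfl
    · simp [visitTime, hu]

variable {P} (hrow : ∀ s, ∑' u, ENNReal.ofReal (P s u) = 1)
include hrow

theorem tsum_firstPassage_le_one (s : S) : ∑' n, firstPassage P t n s ≤ 1 := by
  refine ENNReal.tsum_le_of_sum_range_le fun N => ?_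
  induction N generalizing s with
  | zero => simp
  | succ N ih =>
    rw [Finset.sum_range_succ', add_comm]
    simp only [firstPassage]
    rw [← hrow s, ENNReal.tsum_eq_add_tsum_ite (f := fun u => ENNReal.ofReal (P s u)) t,
      ← Summable.tsum_finsetSum fun _ _ => ENNReal.summable]
    refine add_le_add le_rfl (ENNReal.tsum_le_tsum fun u => ?_)
    split_ifs with hu
    · simp
    · rw [← Finset.mul_sum]
      simpa using mul_le_mul_right (ih u) (ENNReal.ofReal (P s u))

theorem visitProb_le_one (s : S) : visitProb P t s ≤ 1 := by
  unfold visitProb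
  split_ifs
  · exact le_rfl
  · exact tsum_firstPassage_le_one t hrow s

variable (hP : P.IsIrreducible) {t}
include hP

/-- An average of numbers at most 1 equals 1 only if all of positive weight do, so certainty spreads
from `t` along transitions. -/
theorem visitProb_eq_one (ht : returnProb P t = 1) (s : S) : visitProb P t s = 1 := by
  refine IsIrreducible.propagate hP (fun s => visitProb P t s = 1) (fun s u hsu hs => ?_)
    (s := t) (by simp [visitProb]) s
  have h1 : ∑' n, firstPassage P t n s = 1 := by
    by_cases hst : s = t
    · rw [hst]; exact ht
    · simpa [visitProb, hst] using hs
  rw [tsum_firstPassage] at h1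
  exact eq_one_of_one_le_tsum_mul (hrow s) (visitProb_le_one t hrow) h1.ge
    (by simpa using hsu)

omit hrow in
theorem visitTime_lt_top (ht : meanReturnTime P t < ⊤) (s : S) : visitTime P t s < ⊤ := by
  refine IsIrreducible.propagate hP (fun s => visitTime P t s < ⊤) (fun s u hsu hs => ?_)
    (s := t) (by simp [visitTime]) s
  have h1 : ∑' n : ℕ, ((n : ℝ≥0∞) + 1) * firstPassage P t n s < ⊤ := by
    by_cases hst : s = t
    · rw [hst]; exact ht
    · simpa [visitTime, hst] using hs
  rw [tsum_mul_firstPassage] at h1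
  have h2 := ((ENNReal.le_tsum u).trans le_add_self).trans_lt h1
  exact ENNReal.lt_top_of_mul_ne_top_right h2.ne (by simpa using hsu)

/-- For a transient state `t`, the probability of visiting `t` has no minimum. -/
theorem not_exists_min_visitProb (ht : returnProb P t < 1) :
    ¬ ∃ s, ∀ u, visitProb P t s ≤ visitProb P t u := by
  rintro ⟨s, hs⟩
  have hs1 := visitProb_le_one t hrow s
  rcases hs1.eq_or_lt with h1 | h1
  · have h2 : ∀ u, visitProb P t u = 1 := fun u =>
      le_antisymm (visitProb_le_one t hrow u) (h1 ▸ hs u)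
    have h3 := tsum_firstPassage P t t
    simp only [h2, mul_one, hrow] at h3
    exact ht.ne h3
  -- A minimum below 1 lies off `t`, where the visit probability is harmonic, so it spreads until it
  -- reaches `t`, where the value is 1.
  · have h2 := IsIrreducible.propagate hP (fun u => visitProb P t u = visitProb P t s)
      (fun a u hau ha => ?_) (s := s) rfl t
    · simp only [visitProb, if_true] at h2
      exact h1.ne h2.symm
    · have hat : a ≠ t := by
        rintro rfl
        simp only [visitProb, if_true] at ha
        exact h1.ne ha.symm
      have h3 := tsum_firstPassage P t a
      have h4 : visitProb P t a = ∑' n, firstPassage P t n a := if_neg hat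
      rw [← h4, ha] at h3
      exact eq_of_tsum_mul_le (hrow a) (h1.trans ENNReal.one_lt_top).ne hs h3.ge
        (by simpa using hau)

end Chain

/-! ### Recurrence of a QBD and the stochasticity of `G` and `Ĝ` -/

variable {m : ℕ} {B Am A0 A1 G Gh : Matrix (Fin m) (Fin m) ℝ}

theorem tsum_transitionMatrix_succ (f : ℕ × Fin m → ℝ≥0∞) (n : ℕ) (i : Fin m) :
    ∑' u, ENNReal.ofReal (transitionMatrix B Am A0 A1 (n + 1, i) u) * f u =
      ∑ j, ENNReal.ofReal (Am i j) * f (n, j) + ∑ j, ENNReal.ofReal (A0 i j) * f (n + 1, j) +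
        ∑ j, ENNReal.ofReal (A1 i j) * f (n + 2, j) := by
  rw [ENNReal.tsum_prod', tsum_eq_sum (s := {n, n + 1, n + 2})]
  · rw [Finset.sum_insert (by simp), Finset.sum_insert (by simp), Finset.sum_singleton, add_assoc]
    have h0 : ¬ n = n + 1 + 1 := by omega
    simp [tsum_fintype, transitionMatrix, h0]
  · intro b hb
    simp only [Finset.mem_insert, Finset.mem_singleton, not_or] at hb
    rw [tsum_fintype]
    refine Finset.sum_eq_zero fun j _ => ?_
    have h1 : ¬ b = n + 1 + 1 := hb.2.2
    have h2 : ¬ n = b := fun h => hb.1 h.symm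
    simp [transitionMatrix, h1, h2, hb.2.1]

theorem tsum_transitionMatrix_zero (f : ℕ × Fin m → ℝ≥0∞) (i : Fin m) :
    ∑' u, ENNReal.ofReal (transitionMatrix B Am A0 A1 (0, i) u) * f u =
      ∑ j, ENNReal.ofReal (B i j) * f (0, j) + ∑ j, ENNReal.ofReal (A1 i j) * f (1, j) := by
  rw [ENNReal.tsum_prod', tsum_eq_sum (s := {0, 1})]
  · rw [Finset.sum_insert (by simp), Finset.sum_singleton]
    simp [tsum_fintype, transitionMatrix]
  · intro b hb
    simp only [Finset.mem_insert, Finset.mem_singleton, not_or] at hb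
    rw [tsum_fintype]
    refine Finset.sum_eq_zero fun j _ => ?_
    simp [transitionMatrix, hb.1, hb.2]

theorem sum_ofReal_mul {a : Fin m → ℝ} {f : Fin m → ℝ≥0∞} (ha : ∀ j, 0 ≤ a j)
    (hf : ∀ j, f j ≠ ⊤) :
    ∑ j, ENNReal.ofReal (a j) * f j = ENNReal.ofReal (∑ j, a j * (f j).toReal) := by
  rw [ENNReal.ofReal_sum_of_nonneg fun j _ => mul_nonneg (ha j) ENNReal.toReal_nonneg]
  refine Finset.sum_congr rfl fun j _ => ?_
  rw [ENNReal.ofReal_mul (ha j), ENNReal.ofReal_toReal (hf j)]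

section

variable (hQ : IsQBD B Am A0 A1)
include hQ

theorem IsQBD.tsum_row (s : ℕ × Fin m) :
    ∑' u, ENNReal.ofReal (transitionMatrix B Am A0 A1 s u) = 1 := by
  have hsum : ∀ a : Fin m → ℝ, (∀ j, 0 ≤ a j) →
      ∑ j, ENNReal.ofReal (a j) = ENNReal.ofReal (∑ j, a j) := fun a ha =>
    (ENNReal.ofReal_sum_of_nonneg fun j _ => ha j).symm
  have hnn : ∀ a : Fin m → ℝ, (∀ j, 0 ≤ a j) → 0 ≤ ∑ j, a j := fun a ha =>
    Finset.sum_nonneg fun j _ => ha j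
  rcases s with ⟨_ | n, i⟩
  · have h1 := tsum_transitionMatrix_zero (B := B) (Am := Am) (A0 := A0) (A1 := A1) (fun _ => 1) i
    simp only [mul_one] at h1
    rw [h1, hsum _ (hQ.B_nonneg i), hsum _ (hQ.A1_nonneg i),
      ← ENNReal.ofReal_add (hnn _ (hQ.B_nonneg i)) (hnn _ (hQ.A1_nonneg i)),
      ← Finset.sum_add_distrib]
    have := hQ.row_sum_zero i
    simp only [Matrix.add_apply] at this
    rw [this, ENNReal.ofReal_one]
  · have h1 := tsum_transitionMatrix_succ (B := B) (Am := Am) (A0 := A0) (A1 := A1)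
      (fun _ => 1) n i
    simp only [mul_one] at h1
    rw [h1, hsum _ (hQ.Am_nonneg i), hsum _ (hQ.A0_nonneg i), hsum _ (hQ.A1_nonneg i),
      ← ENNReal.ofReal_add (hnn _ (hQ.Am_nonneg i)) (hnn _ (hQ.A0_nonneg i)),
      ← ENNReal.ofReal_add (add_nonneg (hnn _ (hQ.Am_nonneg i)) (hnn _ (hQ.A0_nonneg i)))
        (hnn _ (hQ.A1_nonneg i)), ← Finset.sum_add_distrib, ← Finset.sum_add_distrib]
    have := hQ.row_sum_succ i
    simp only [Matrix.add_apply] at this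
    rw [this, ENNReal.ofReal_one]

theorem IsQBD.tsum_transitionMatrix_succ_toReal {f : ℕ × Fin m → ℝ≥0∞} (hf : ∀ u, f u ≠ ⊤)
    (n : ℕ) (i : Fin m) :
    (∑' u, ENNReal.ofReal (transitionMatrix B Am A0 A1 (n + 1, i) u) * f u) =
      ENNReal.ofReal ((Am *ᵥ fun j => (f (n, j)).toReal) i +
        (A0 *ᵥ fun j => (f (n + 1, j)).toReal) i + (A1 *ᵥ fun j => (f (n + 2, j)).toReal) i) := by
  have hnn : ∀ (a g : Fin m → ℝ), (∀ j, 0 ≤ a j) → (∀ j, 0 ≤ g j) → 0 ≤ ∑ j, a j * g j :=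
    fun a g ha hg => Finset.sum_nonneg fun j _ => mul_nonneg (ha j) (hg j)
  have h1 := hnn _ (fun j => (f (n, j)).toReal) (hQ.Am_nonneg i) fun _ => ENNReal.toReal_nonneg
  have h2 := hnn _ (fun j => (f (n + 1, j)).toReal) (hQ.A0_nonneg i)
    fun _ => ENNReal.toReal_nonneg
  have h3 := hnn _ (fun j => (f (n + 2, j)).toReal) (hQ.A1_nonneg i)
    fun _ => ENNReal.toReal_nonneg
  rw [tsum_transitionMatrix_succ, sum_ofReal_mul (hQ.Am_nonneg i) fun j => hf _,
    sum_ofReal_mul (hQ.A0_nonneg i) fun j => hf _, sum_ofReal_mul (hQ.A1_nonneg i) fun j => hf _,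
    ← ENNReal.ofReal_add h1 h2, ← ENNReal.ofReal_add (add_nonneg h1 h2) h3]
  rfl

variable (hG : IsMinNonnegSol (fun X => Am + (A0 - 1) * X + A1 * X ^ 2) G)
  (hGh : IsMinNonnegSol (fun X => A1 + (A0 - 1) * X + Am * X ^ 2) Gh)
include hG

/-- The probability of never visiting a state of level 0 is harmonic on the levels ≥ 1. A stochastic
`G` bounds it by its maximum on level 0, which is finite, so the visit probability would attain a
minimum. -/
theorem IsQBD.not_stochastic_of_transient
    (ht : IsTransient (transitionMatrix B Am A0 A1)) : ¬ G *ᵥ 1 = 1 := by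
  intro h1
  obtain ⟨i₀, -⟩ := hQ.blocks.max_principle
  have : Nonempty (Fin m) := ⟨i₀⟩
  set P := transitionMatrix B Am A0 A1 with hPdef
  set t : ℕ × Fin m := (0, i₀) with htdef
  have hle := visitProb_le_one t hQ.tsum_row
  have hfin : ∀ u, visitProb P t u ≠ ⊤ := fun u => ((hle u).trans_lt ENNReal.one_lt_top).ne
  set f : ℕ → Fin m → ℝ := fun n i => (visitProb P t (n, i)).toReal with hf
  have hharm : ∀ n, f (n + 1) = Am *ᵥ f n + A0 *ᵥ f (n + 1) + A1 *ᵥ f (n + 2) := fun n => by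
    ext i
    have h2 : visitProb P t (n + 1, i) = _ := if_neg (by simp [htdef])
    simp only [hf]
    rw [h2, tsum_firstPassage, hQ.tsum_transitionMatrix_succ_toReal hfin,
      ENNReal.toReal_ofReal]
    · rfl
    · exact add_nonneg (add_nonneg
        (EntryNonneg.mulVec_nonneg hQ.Am_nonneg (fun _ => ENNReal.toReal_nonneg) i)
        (EntryNonneg.mulVec_nonneg hQ.A0_nonneg (fun _ => ENNReal.toReal_nonneg) i))
        (EntryNonneg.mulVec_nonneg hQ.A1_nonneg (fun _ => ENNReal.toReal_nonneg) i)
  have hsub : ∀ n, (1 - f) (n + 1) ≤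
      Am *ᵥ (1 - f) n + A0 *ᵥ (1 - f) (n + 1) + A1 *ᵥ (1 - f) (n + 2) := fun n => by
    intro i
    have e1 := congrFun hQ.row_sum i
    have e2 := congrFun (hharm n) i
    simp only [Pi.sub_apply, Pi.one_apply, Pi.add_apply, Matrix.mulVec_sub] at e1 e2 ⊢
    linarith
  have hbound := hQ.blocks.le_mulVec_of_subharmonic hG h1 (e := 1 - f) (c := 1)
    (fun n i => by simp [hf]) hsub
  obtain ⟨i, hi⟩ := Finite.exists_max ((1 - f) 0)
  have hall : ∀ n k, (1 - f) n k ≤ (1 - f) 0 i := fun n => by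
    induction n with
    | zero => exact hi
    | succ n ih => exact fun k => (hbound n k).trans (mulVec_le_of_stochastic hG.1 h1 ih k)
  refine not_exists_min_visitProb hQ.tsum_row hQ.irreducible (ht t) ⟨(0, i), fun u => ?_⟩
  have h2 := hall u.1 u.2
  simp only [Pi.sub_apply, Pi.one_apply, hf, sub_le_sub_iff_left] at h2
  exact (ENNReal.toReal_le_toReal (hfin _) (hfin _)).1 h2

include hGh

/-- The mean time to hit a fixed state of level 0 is finite and serves as the supersolution τ. -/
theorem IsQBD.not_both_stochastic_of_positiveRecurrent
    (ht : IsPositiveRecurrent (transitionMatrix B Am A0 A1)) :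
    ¬ (G *ᵥ 1 = 1 ∧ Gh *ᵥ 1 = 1) := by
  obtain ⟨i₀, -⟩ := hQ.blocks.max_principle
  set P := transitionMatrix B Am A0 A1 with hPdef
  set t : ℕ × Fin m := (0, i₀) with htdef
  have hprob := visitProb_eq_one hQ.tsum_row hQ.irreducible (ht t).1
  have hfin : ∀ u, visitTime P t u ≠ ⊤ := fun u =>
    (visitTime_lt_top hQ.irreducible (ht t).2 u).ne
  refine hQ.blocks.not_both_stochastic_of_mean_time hG hGh
    (τ := fun n i => (visitTime P t (n, i)).toReal) (fun n i => ENNReal.toReal_nonneg)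
    fun n i => ?_
  have h1 : visitProb P t (n + 1, i) = _ := if_neg (by simp [htdef])
  have h2 : visitTime P t (n + 1, i) = _ := if_neg (by simp [htdef])
  rw [tsum_mul_firstPassage, ← h1, hprob, hQ.tsum_transitionMatrix_succ_toReal hfin] at h2
  have h3 := congrArg ENNReal.toReal h2
  rw [ENNReal.toReal_add ENNReal.one_ne_top ENNReal.ofReal_ne_top, ENNReal.toReal_ofReal,
    ENNReal.toReal_one] at h3
  · simp only [Pi.add_apply, Pi.one_apply]
    linarith
  · exact add_nonneg (add_nonneg
      (EntryNonneg.mulVec_nonneg hQ.Am_nonneg (fun _ => ENNReal.toReal_nonneg) i)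
      (EntryNonneg.mulVec_nonneg hQ.A0_nonneg (fun _ => ENNReal.toReal_nonneg) i))
      (EntryNonneg.mulVec_nonneg hQ.A1_nonneg (fun _ => ENNReal.toReal_nonneg) i)

/-- If the QBD is not null recurrent, then the powers of `G` or those of `Ĝ` tend to zero. -/
theorem IsQBD.tendsto_zero_or_tendsto_zero
    (hrec : IsPositiveRecurrent (transitionMatrix B Am A0 A1) ∨
      IsTransient (transitionMatrix B Am A0 A1)) :
    Tendsto (fun n => G ^ n) atTop (𝓝 0) ∨ Tendsto (fun n => Gh ^ n) atTop (𝓝 0) := by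
  rcases hQ.blocks.stochastic_or_tendsto_zero hG with h1 | h1
  · rcases hQ.blocks.swap.stochastic_or_tendsto_zero hGh with h2 | h2
    · rcases hrec with hr | hr
      · exact absurd ⟨h1, h2⟩ (hQ.not_both_stochastic_of_positiveRecurrent hG hGh hr)
      · exact absurd h1 (hQ.not_stochastic_of_transient hG hr)
    · exact Or.inr h2
  · exact Or.inl h1

end

end QBD

namespace QBD

/-! ### The difference equation -/

/-- All eigenvalues vanish, so the characteristic polynomial is a power of X, and Cayley–Hamilton
applies. -/
theorem isNilpotent_of_spectralRadius_eq_zero {q : ℕ} {V : Matrix (Fin q) (Fin q) ℂ}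
    (hV : spectralRadius ℂ V = 0) : IsNilpotent V := by
  have hroots : ∀ z ∈ V.charpoly.roots, z = 0 := fun z hz => by
    have hz' : z ∈ spectrum ℂ V :=
      Matrix.mem_spectrum_iff_isRoot_charpoly.2 (Polynomial.isRoot_of_mem_roots hz)
    have h1 : (‖z‖₊ : ℝ≥0∞) ≤ spectralRadius ℂ V := le_iSup₂ (f := fun k (_ : k ∈ spectrum ℂ V) =>
      (‖k‖₊ : ℝ≥0∞)) z hz'
    rw [hV] at h1
    simpa using h1
  have hX : V.charpoly = Polynomial.X ^ Multiset.card V.charpoly.roots := by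
    conv_lhs => rw [(IsAlgClosed.splits V.charpoly).eq_prod_roots_of_monic V.charpoly_monic]
    rw [Multiset.eq_replicate_card.2 hroots]
    simp
  refine ⟨Multiset.card V.charpoly.roots, ?_⟩
  have := Matrix.aeval_self_charpoly V
  rw [hX] at this
  simpa using this

section

variable {m p q : ℕ} {Am A0 A1 G Gh W : Matrix (Fin m) (Fin m) ℂ}
  {L : Matrix (Fin m) (Fin p) ℂ} {K : Matrix (Fin m) (Fin q) ℂ}
  {V1 : Matrix (Fin p) (Fin p) ℂ} {V0 : Matrix (Fin q) (Fin q) ℂ}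
  {E : Matrix (Fin p) (Fin m) ℂ} {F : Matrix (Fin q) (Fin m) ℂ}

/-- Coefficient of `-g k` in the particular solution `sigma` at `s`. -/
noncomputable def sigmaCoeff (G W : Matrix (Fin m) (Fin m) ℂ)
    (L : Matrix (Fin m) (Fin p) ℂ) (K : Matrix (Fin m) (Fin q) ℂ)
    (V1 : Matrix (Fin p) (Fin p) ℂ) (V0 : Matrix (Fin q) (Fin q) ℂ)
    (E : Matrix (Fin p) (Fin m) ℂ) (F : Matrix (Fin q) (Fin m) ℂ) (s k : ℕ) :
    Matrix (Fin m) (Fin m) ℂ :=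
  if k ≤ s then (G ^ (s - k) - L * V1⁻¹ ^ (s - k) * E) * W else K * V0 ^ (k - s) * F * W

/-- Terms with k - s ≥ ν vanish, so the range may be extended. The values of σ at r, r + 1, r + 2
can then be summed over one common range. -/
theorem sigma_eq_sum (hV0 : IsNilpotent V0) (g : ℕ → Fin m → ℂ) {s n : ℕ}
    (hn : s + nilpotencyClass V0 + 1 ≤ n) :
    sigma G W L K V1 V0 E F g s =
      -∑ k ∈ Finset.Ico 1 n, sigmaCoeff G W L K V1 V0 E F s k *ᵥ g k := by
  obtain ⟨M, rfl⟩ : ∃ M, n = M + s := ⟨n - s, by omega⟩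
  rw [← Finset.sum_Ico_consecutive _ (show 1 ≤ s + 1 by omega) (show s + 1 ≤ M + s by omega),
    neg_add, ← sub_eq_add_neg, sigma]
  congr 1
  · congr 1
    refine Finset.sum_congr (by ext; simp) fun k hk => ?_
    rw [sigmaCoeff, if_pos]
    simp only [Finset.mem_Ico] at hk
    omega
  · rw [add_comm s 1, ← Finset.sum_Ico_add']
    have h1 : ∀ j ∈ Finset.Ico 1 M, sigmaCoeff G W L K V1 V0 E F s (j + s) *ᵥ g (j + s) =
        (K * V0 ^ j * F * W) *ᵥ g (j + s) := fun j hj => by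
      simp only [Finset.mem_Ico] at hj
      rw [sigmaCoeff, if_neg (by omega), Nat.add_sub_cancel]
    rw [Finset.sum_congr rfl h1]
    refine Finset.sum_subset (fun j hj => ?_) fun j hj hj' => ?_
    · simp only [Finset.mem_Ico] at hj ⊢
      omega
    · simp only [Finset.mem_Ico] at hj hj'
      have : V0 ^ j = 0 := pow_eq_zero_of_le (by omega) (pow_nilpotencyClass hV0)
      simp [this]

variable (hG : Am + (A0 - 1) * G + A1 * G ^ 2 = 0)
  (hGh : A1 + (A0 - 1) * Gh + Am * Gh ^ 2 = 0)
  (hL : Gh * L = L * V1) (hK : Gh * K = K * V0) (hV1 : IsUnit V1)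

include hG in
theorem pow_sol_homogeneous (d : ℕ) :
    Am * G ^ d + (A0 - 1) * G ^ (d + 1) + A1 * G ^ (d + 2) = 0 := by
  have := congrArg (fun X => X * G ^ d) hG
  simpa only [add_mul, zero_mul, mul_assoc, ← pow_succ', ← pow_add, add_comm 2 d] using this

include hV1 in
theorem inv_pow_succ_mul (d : ℕ) : V1 * V1⁻¹ ^ (d + 1) = V1⁻¹ ^ d := by
  rw [pow_succ', ← mul_assoc, Matrix.mul_nonsing_inv _ ((Matrix.isUnit_iff_isUnit_det _).1 hV1),
    one_mul]

include hGh hL hV1 in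
theorem inv_pow_homogeneous (d : ℕ) :
    Am * (L * V1⁻¹ ^ d) + (A0 - 1) * (L * V1⁻¹ ^ (d + 1)) + A1 * (L * V1⁻¹ ^ (d + 2)) = 0 := by
  have h1 : ∀ d, L * V1⁻¹ ^ d = Gh * (L * V1⁻¹ ^ (d + 1)) := fun d => by
    rw [← Matrix.mul_assoc, hL, Matrix.mul_assoc, inv_pow_succ_mul hV1]
  have h2 := congrArg (fun X => X * (L * V1⁻¹ ^ (d + 2))) hGh
  simp only [Matrix.add_mul, pow_two, Matrix.mul_assoc, Matrix.zero_mul] at h2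
  rw [← h1, ← h1] at h2
  rw [← h2]
  abel

include hGh hK in
theorem nilpotent_pow_homogeneous (d : ℕ) :
    Am * (K * V0 ^ (d + 2)) + (A0 - 1) * (K * V0 ^ (d + 1)) + A1 * (K * V0 ^ d) = 0 := by
  have h1 : ∀ d, K * V0 ^ (d + 1) = Gh * (K * V0 ^ d) := fun d => by
    rw [← Matrix.mul_assoc, hK, Matrix.mul_assoc, pow_succ']
  have h2 := congrArg (fun X => X * (K * V0 ^ d)) hGh
  simp only [Matrix.add_mul, pow_two, Matrix.mul_assoc, Matrix.zero_mul] at h2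
  rw [← h1, ← h1] at h2
  rw [← h2]
  abel

variable (hW : (Am * Gh + (A0 - 1) + A1 * G) * W = 1) (hLK : L * E + K * F = 1)

include hG hGh hL hK hV1 hW hLK in
-- The Green function identity. The two formulas for the coefficient agree at k = s because I - LE =
-- KF, so only k = r + 1 mixes both sides. There KV₀F = Ĝ - LV₁E, the terms in `L` cancel, and HW =
-- I remains.
theorem sigmaCoeff_equation (r k : ℕ) :
    Am * sigmaCoeff G W L K V1 V0 E F r k + (A0 - 1) * sigmaCoeff G W L K V1 V0 E F (r + 1) k +
      A1 * sigmaCoeff G W L K V1 V0 E F (r + 2) k = if k = r + 1 then 1 else 0 := by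
  have hge : ∀ s d, sigmaCoeff G W L K V1 V0 E F s (s + d) = K * V0 ^ d * F * W := fun s d => by
    rcases Nat.eq_zero_or_pos d with rfl | hd
    · rw [sigmaCoeff, if_pos (by omega)]
      simp [← hLK]
    · rw [sigmaCoeff, if_neg (by omega), Nat.add_sub_cancel_left]
  have hle : ∀ k d, sigmaCoeff G W L K V1 V0 E F (k + d) k =
      (G ^ d - L * V1⁻¹ ^ d * E) * W := fun k d => by
    rw [sigmaCoeff, if_pos (by omega), Nat.add_sub_cancel_left]
  rcases lt_trichotomy k (r + 1) with hk | hk | hk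
  · obtain ⟨d, rfl⟩ : ∃ d, r = k + d := ⟨r - k, by omega⟩
    rw [if_neg (by omega), hle, add_assoc k d 1, hle, add_assoc k d 2, hle]
    have h1 := pow_sol_homogeneous hG d
    have h2 := inv_pow_homogeneous hGh hL hV1 d
    calc _ = (Am * G ^ d + (A0 - 1) * G ^ (d + 1) + A1 * G ^ (d + 2) -
          (Am * (L * V1⁻¹ ^ d) + (A0 - 1) * (L * V1⁻¹ ^ (d + 1)) +
            A1 * (L * V1⁻¹ ^ (d + 2))) * E) * W := by
            simp only [Matrix.add_mul, Matrix.sub_mul, Matrix.mul_sub, Matrix.mul_assoc]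
            abel
      _ = 0 := by rw [h1, h2]; simp
  · subst hk
    rw [if_pos rfl, hge r 1]
    have e1 := hge (r + 1) 0
    have e2 := hle (r + 1) 1
    rw [add_zero] at e1
    rw [show r + 2 = r + 1 + 1 from rfl, e1, e2]
    have h2 := inv_pow_homogeneous hGh hL hV1 0
    have hKF : K * F = 1 - L * E := by rw [← hLK]; abel
    have hKV : K * V0 * F = Gh - L * V1 * E := by
      rw [← hK, ← hL, Matrix.mul_assoc, hKF, Matrix.mul_sub, Matrix.mul_one, Matrix.mul_assoc]
    simp only [pow_one, pow_zero, Matrix.mul_one, hKV, hKF]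
    have h4 : Am * (L * V1) + (A0 - 1) * L + A1 * (L * V1⁻¹) = 0 := by
      have h5 := congrArg (fun X => X * V1) h2
      have h6 : V1⁻¹ * V1 = 1 :=
        Matrix.nonsing_inv_mul _ ((Matrix.isUnit_iff_isUnit_det _).1 hV1)
      simpa [Matrix.add_mul, Matrix.mul_assoc, h6, pow_two] using h5
    calc _ = (Am * Gh + (A0 - 1) + A1 * G -
          (Am * (L * V1) + (A0 - 1) * L + A1 * (L * V1⁻¹)) * E) * W := by
            simp only [Matrix.add_mul, Matrix.sub_mul, Matrix.mul_sub, Matrix.mul_assoc,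
              Matrix.one_mul]
            abel
      _ = 1 := by rw [h4, Matrix.zero_mul, sub_zero, hW]
  · obtain ⟨d, rfl⟩ : ∃ d, k = r + 2 + d := ⟨k - (r + 2), by omega⟩
    have e1 := hge r (d + 2)
    have e2 := hge (r + 1) (d + 1)
    rw [show r + (d + 2) = r + 2 + d by omega] at e1
    rw [show r + 1 + (d + 1) = r + 2 + d by omega] at e2
    rw [if_neg (by omega), e1, e2, hge]
    have h1 := nilpotent_pow_homogeneous hGh hK d
    calc _ = (Am * (K * V0 ^ (d + 2)) + (A0 - 1) * (K * V0 ^ (d + 1)) +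
          A1 * (K * V0 ^ d)) * (F * W) := by
            simp only [Matrix.add_mul, Matrix.mul_assoc]
      _ = 0 := by rw [h1, Matrix.zero_mul]

include hG hGh hL hK hV1 hW hLK in
theorem sigma_solves (hV0 : IsNilpotent V0) (g : ℕ → Fin m → ℂ) :
    SolvesDiffEq Am A0 A1 g (sigma G W L K V1 V0 E F g) := by
  intro r
  set n := r + 2 + nilpotencyClass V0 + 1 with hn
  rw [sigma_eq_sum hV0 g (s := r) (n := n) (by omega),
    sigma_eq_sum hV0 g (s := r + 1) (n := n) (by omega),
    sigma_eq_sum hV0 g (s := r + 2) (n := n) (by omega)]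
  simp only [Matrix.mulVec_neg, Matrix.mulVec_sum, Matrix.mulVec_mulVec]
  rw [← neg_add, ← neg_add, ← Finset.sum_add_distrib, ← Finset.sum_add_distrib]
  simp only [← Matrix.add_mulVec, sigmaCoeff_equation hG hGh hL hK hV1 hW hLK]
  congr 1
  rw [Finset.sum_eq_single (r + 1)]
  · simp
  · intro k _ hk
    simp [hk]
  · intro hr
    exact absurd (Finset.mem_Ico.2 ⟨by omega, by omega⟩) hr

include hG hGh hL hV1 in
theorem homogeneous_solves (x : Fin m → ℂ) (y : Fin p → ℂ) :
    SolvesDiffEq Am A0 A1 0 fun r => (G ^ r) *ᵥ x + (L * V1⁻¹ ^ r) *ᵥ y := by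
  intro r
  have h1 := congrArg (fun X => X *ᵥ x) (pow_sol_homogeneous hG r)
  have h2 := congrArg (fun X => X *ᵥ y) (inv_pow_homogeneous hGh hL hV1 r)
  simp only [Matrix.add_mulVec, Matrix.zero_mulVec, ← Matrix.mulVec_mulVec] at h1 h2
  simp only [Matrix.mulVec_add, ← Matrix.mulVec_mulVec, Pi.zero_apply, neg_zero]
  rw [← add_zero (0 : Fin m → ℂ)]
  nth_rw 1 [← h1]
  rw [← h2]
  abel

theorem SolvesDiffEq.add {g g' u u' : ℕ → Fin m → ℂ} (h : SolvesDiffEq Am A0 A1 g u)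
    (h' : SolvesDiffEq Am A0 A1 g' u') : SolvesDiffEq Am A0 A1 (g + g') (u + u') := fun r => by
  simp only [Pi.add_apply, Matrix.mulVec_add, neg_add, ← h r, ← h' r]
  abel

theorem SolvesDiffEq.sub {g g' u u' : ℕ → Fin m → ℂ} (h : SolvesDiffEq Am A0 A1 g u)
    (h' : SolvesDiffEq Am A0 A1 g' u') : SolvesDiffEq Am A0 A1 (g - g') (u - u') := fun r => by
  simp only [Pi.sub_apply, Matrix.mulVec_sub, neg_sub', ← h r, ← h' r]
  abel

include hG hGh hL hK hV1 hW hLK in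
/-- Every solution of the homogeneous equation is a combination of the given ones. -/
theorem exists_of_homogeneous (hV0 : IsNilpotent V0) (hFL : F * L = 0) (hFK : F * K = 1)
    (hEL : E * L = 1) (hEK : E * K = 0) {v : ℕ → Fin m → ℂ} (hv : SolvesDiffEq Am A0 A1 0 v) :
    ∃ (x : Fin m → ℂ) (y : Fin p → ℂ), ∀ r, v r = (G ^ r) *ᵥ x + (L * V1⁻¹ ^ r) *ᵥ y := by
  set V := 1 - (A0 + A1 * G) with hV
  set N := 1 - G * Gh with hN
  -- The factorization is rebuilt over ℂ from the two equations and HW = I alone: H = -VN, so N⁻¹ =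
  -- -WV.
  have hVG : V * G = Am := by
    rw [← sub_eq_zero, ← neg_eq_zero, ← hG, hV]
    noncomm_ring
  have hVNW : V * (N * -W) = 1 := by
    rw [← hW, ← hVG, hN, hV]
    noncomm_ring
  have hVNW' : N * -W * V = 1 := mul_eq_one_comm.1 hVNW
  have hNWV : N * (-W * V) = 1 := by rw [← mul_assoc, hVNW']
  have hNWV' : -W * V * N = 1 := mul_eq_one_comm.1 hNWV
  have hA1 : A1 * N = V * N * Gh := by
    rw [← sub_eq_zero, ← hGh, ← hVG, hN, hV]
    noncomm_ring
  have hA1' : -W * A1 = Gh * (-W * V) := by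
    calc -W * A1 = -W * (A1 * N) * (-W * V) := by
          rw [mul_assoc, mul_assoc, hNWV, mul_one]
      _ = (-W * V * N) * Gh * (-W * V) := by rw [hA1]; noncomm_ring
      _ = Gh * (-W * V) := by rw [hNWV', one_mul]
  -- The factor A₋₁ = VG reduces the order: the defect satisfies a first-order recursion, which N⁻¹
  -- turns into zᵣ = Ĝzᵣ₊₁.
  set w : ℕ → Fin m → ℂ := fun r => v (r + 1) - G *ᵥ v r with hw
  have hVw : ∀ r, V *ᵥ w r = A1 *ᵥ w (r + 1) := fun r => by
    have h1 := hv r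
    rw [← hVG, Pi.zero_apply, neg_zero] at h1
    rw [← sub_eq_zero, ← neg_eq_zero, ← h1]
    simp only [hw, hV, Matrix.mulVec_sub, Matrix.sub_mulVec, Matrix.add_mulVec,
      Matrix.one_mulVec, ← Matrix.mulVec_mulVec]
    abel
  set z : ℕ → Fin m → ℂ := fun r => (-W * V) *ᵥ w r with hz
  have hwz : ∀ r, w r = N *ᵥ z r := fun r => by
    rw [hz, Matrix.mulVec_mulVec, hNWV, Matrix.one_mulVec]
  have hzz : ∀ r, z r = Gh *ᵥ z (r + 1) := fun r => by
    simp only [hz]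
    rw [← Matrix.mulVec_mulVec, hVw, Matrix.mulVec_mulVec, hA1', ← Matrix.mulVec_mulVec]
  clear_value z
  have hEGh : E * Gh = V1 * E := by
    calc E * Gh = E * (Gh * L) * E + E * (Gh * K) * F := by
          rw [Matrix.mul_assoc, Matrix.mul_assoc, Matrix.mul_assoc, Matrix.mul_assoc,
            ← Matrix.mul_add, ← Matrix.mul_add, hLK, Matrix.mul_one]
      _ = V1 * E := by
          rw [hL, hK, ← Matrix.mul_assoc, ← Matrix.mul_assoc, hEL, hEK]
          simp
  have hFGh : F * Gh = V0 * F := by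
    calc F * Gh = F * (Gh * L) * E + F * (Gh * K) * F := by
          rw [Matrix.mul_assoc, Matrix.mul_assoc, Matrix.mul_assoc, Matrix.mul_assoc,
            ← Matrix.mul_add, ← Matrix.mul_add, hLK, Matrix.mul_one]
      _ = V0 * F := by
          rw [hL, hK, ← Matrix.mul_assoc, ← Matrix.mul_assoc, hFL, hFK]
          simp
  have hFz : ∀ k r, F *ᵥ z r = V0 ^ k *ᵥ (F *ᵥ z (r + k)) := fun k => by
    induction k with
    | zero => intro r; simp
    | succ k ih =>
      intro r
      rw [ih r, hzz (r + k), Matrix.mulVec_mulVec (M := F), hFGh, ← Matrix.mulVec_mulVec,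
        Matrix.mulVec_mulVec (M := V0 ^ k), ← pow_succ, add_assoc]
  have hFz0 : ∀ r, F *ᵥ z r = 0 := fun r => by
    rw [hFz (nilpotencyClass V0) r, pow_nilpotencyClass hV0, Matrix.zero_mulVec]
  have hEz : ∀ r, E *ᵥ z r = V1⁻¹ ^ r *ᵥ (E *ᵥ z 0) := fun r => by
    induction r with
    | zero => simp
    | succ r ih =>
      have h1 : V1⁻¹ * V1 = 1 :=
        Matrix.nonsing_inv_mul _ ((Matrix.isUnit_iff_isUnit_det _).1 hV1)
      rw [pow_succ', ← Matrix.mulVec_mulVec, ← ih, hzz r, Matrix.mulVec_mulVec (M := E), hEGh,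
        ← Matrix.mulVec_mulVec, Matrix.mulVec_mulVec, h1, Matrix.one_mulVec]
  -- The factor V₁ shifts the exponent, so that wᵣ = LV₁⁻⁽ʳ⁺¹⁾y - GLV₁⁻ʳy. Hence vᵣ - LV₁⁻ʳy is
  -- multiplied by `G` at each step.
  set y : Fin p → ℂ := V1 *ᵥ (E *ᵥ z 0) with hy
  have hzr : ∀ r, z r = (L * V1⁻¹ ^ (r + 1)) *ᵥ y := fun r => by
    have h1 : V1⁻¹ ^ (r + 1) * V1 = V1⁻¹ ^ r := by
      rw [pow_succ, mul_assoc, Matrix.nonsing_inv_mul _ ((Matrix.isUnit_iff_isUnit_det _).1 hV1),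
        mul_one]
    calc z r = (L * E + K * F) *ᵥ z r := by rw [hLK, Matrix.one_mulVec]
      _ = L *ᵥ (E *ᵥ z r) := by
        rw [Matrix.add_mulVec, ← Matrix.mulVec_mulVec, ← Matrix.mulVec_mulVec, hFz0,
          Matrix.mulVec_zero, add_zero]
      _ = _ := by
        rw [hEz, hy, Matrix.mulVec_mulVec (M := L * V1⁻¹ ^ (r + 1)), Matrix.mul_assoc, h1,
          ← Matrix.mulVec_mulVec]
  clear_value y
  refine ⟨v 0 - L *ᵥ y, y, fun r => ?_⟩
  induction r with
  | zero => simp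
  | succ r ih =>
    have h1 : v (r + 1) = w r + G *ᵥ v r := by simp [hw]
    have h2 : Gh * (L * V1⁻¹ ^ (r + 1)) = L * V1⁻¹ ^ r := by
      rw [← Matrix.mul_assoc, hL, Matrix.mul_assoc, inv_pow_succ_mul hV1]
    rw [h1, hwz, hzr, ih, hN, Matrix.sub_mulVec, Matrix.one_mulVec, Matrix.mulVec_add,
      Matrix.mulVec_mulVec, Matrix.mulVec_mulVec, Matrix.mulVec_mulVec, Matrix.mul_assoc, h2,
      ← pow_succ']
    abel

end

/-! ### Passage to complex matrices and proof of the theorem -/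

theorem toC_mul {m : ℕ} (X Y : Matrix (Fin m) (Fin m) ℝ) : toC (X * Y) = toC X * toC Y :=
  Matrix.map_mul (f := Complex.ofRealHom)

theorem toC_add {m : ℕ} (X Y : Matrix (Fin m) (Fin m) ℝ) : toC (X + Y) = toC X + toC Y :=
  Matrix.map_add Complex.ofReal Complex.ofReal_add X Y

theorem toC_sub {m : ℕ} (X Y : Matrix (Fin m) (Fin m) ℝ) : toC (X - Y) = toC X - toC Y :=
  Matrix.map_sub Complex.ofReal Complex.ofReal_sub X Y

theorem toC_one {m : ℕ} : toC (1 : Matrix (Fin m) (Fin m) ℝ) = 1 :=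
  Matrix.map_one Complex.ofReal Complex.ofReal_zero Complex.ofReal_one

theorem toC_zero {m : ℕ} : toC (0 : Matrix (Fin m) (Fin m) ℝ) = 0 :=
  Matrix.map_zero Complex.ofReal Complex.ofReal_zero

end QBD

theorem lemma4p2 {m p q : ℕ} (hpq : p + q = m)
    (B Am A0 A1 : Matrix (Fin m) (Fin m) ℝ)
    (hQ : QBD.IsQBD B Am A0 A1)
    (hrec : QBD.IsPositiveRecurrent (QBD.transitionMatrix B Am A0 A1) ∨
      QBD.IsTransient (QBD.transitionMatrix B Am A0 A1))
    (G Gh R : Matrix (Fin m) (Fin m) ℝ)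
    (hG : QBD.IsMinNonnegSol (fun X => Am + (A0 - 1) * X + A1 * X ^ 2) G)
    (hGh : QBD.IsMinNonnegSol (fun X => A1 + (A0 - 1) * X + Am * X ^ 2) Gh)
    (hR : QBD.IsMinNonnegSol (fun X => A1 + X * (A0 - 1) + X ^ 2 * Am) R)
    (L : Matrix (Fin m) (Fin p) ℂ) (K : Matrix (Fin m) (Fin q) ℂ)
    (V1 : Matrix (Fin p) (Fin p) ℂ) (V0 : Matrix (Fin q) (Fin q) ℂ)
    (hV1 : IsUnit V1) (hV0 : spectralRadius ℂ V0 = 0)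
    (hJ : QBD.toC Gh * Matrix.fromCols L K =
      Matrix.fromCols L K * Matrix.fromBlocks V1 0 0 V0)
    (E : Matrix (Fin p) (Fin m) ℂ) (F : Matrix (Fin q) (Fin m) ℂ)
    (hM : Matrix.fromCols L K * Matrix.fromRows E F = 1)
    (hM' : Matrix.fromRows E F * Matrix.fromCols L K = 1)
    (g : ℕ → Fin m → ℂ) :
    -- `W` is well defined
    IsUnit (A0 + R * Am - 1) ∧ Summable (QBD.Wterm Am A0 G R) ∧
    -- `σ` is a particular solution
    QBD.SolvesDiffEq (QBD.toC Am) (QBD.toC A0) (QBD.toC A1) g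
      (QBD.sigma (QBD.toC G) (QBD.toC (QBD.W Am A0 G R)) L K V1 V0 E F g) ∧
    -- the general solution
    ∀ u : ℕ → Fin m → ℂ,
      QBD.SolvesDiffEq (QBD.toC Am) (QBD.toC A0) (QBD.toC A1) g u ↔
        ∃ (x : Fin m → ℂ) (y : Fin p → ℂ), ∀ r : ℕ,
          u r = (QBD.toC G ^ r).mulVec x + (L * V1⁻¹ ^ r).mulVec y +
            QBD.sigma (QBD.toC G) (QBD.toC (QBD.W Am A0 G R)) L K V1 V0 E F g r := by
  open QBD in
  obtain ⟨hU, hS, hW⟩ := hQ.blocks.W_spec hG hGh hR (hQ.tendsto_zero_or_tendsto_zero hG hGh hrec)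
  have hnil := isNilpotent_of_spectralRadius_eq_zero hV0
  rw [Matrix.mul_fromCols, Matrix.fromCols_mul_fromBlocks] at hJ
  obtain ⟨hL, hK⟩ := Matrix.fromCols_inj hJ
  rw [Matrix.mul_zero, add_zero] at hL
  rw [Matrix.mul_zero, zero_add] at hK
  rw [Matrix.fromCols_mul_fromRows] at hM
  rw [Matrix.fromRows_mul_fromCols, ← Matrix.fromBlocks_one, Matrix.fromBlocks_inj] at hM'
  obtain ⟨hEL, hEK, hFL, hFK⟩ := hM'
  have hG' : toC Am + (toC A0 - 1) * toC G + toC A1 * toC G ^ 2 = 0 := by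
    have := congrArg toC hG.2.1
    simpa only [toC_add, toC_mul, toC_sub, toC_one, toC_zero, pow_two] using this
  have hGh' : toC A1 + (toC A0 - 1) * toC Gh + toC Am * toC Gh ^ 2 = 0 := by
    have := congrArg toC hGh.2.1
    simpa only [toC_add, toC_mul, toC_sub, toC_one, toC_zero, pow_two] using this
  have hW' : (toC Am * toC Gh + (toC A0 - 1) + toC A1 * toC G) * toC (QBD.W Am A0 G R) = 1 := by
    have := congrArg toC hW
    simpa only [toC_add, toC_mul, toC_sub, toC_one] using this
  have hσ := sigma_solves hG' hGh' hL hK hV1 hW' hM hnil g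
  refine ⟨hU, hS, hσ, fun u => ⟨fun hu => ?_, ?_⟩⟩
  · have h0 := hu.sub hσ
    rw [sub_self] at h0
    obtain ⟨x, y, hxy⟩ :=
      exists_of_homogeneous hG' hGh' hL hK hV1 hW' hM hnil hFL hFK hEL hEK h0
    exact ⟨x, y, fun r => by rw [← hxy r]; simp⟩
  · rintro ⟨x, y, hxy⟩
    have h1 := (homogeneous_solves hG' hGh' hL hV1 x y).add hσ
    rw [zero_add] at h1
    have h2 : u = _ := funext hxy
    rw [h2]
    exact h1
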